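/- Let $X$ be a $2\times 2$ game with real payoff matrices $(a_{ij})$ for the row player and $(b_{ij})$ for the column player. Let $\Delta$ be the open simplex of positive real matrices $P=(p_{ij})_{1\le i,j\le 2}$ with $\sum_{i,j} p_{ij}=1$; its boundary consists of the nonnegative matrices with entry sum $1$ and at least one zero entry. Let $\mathcal V_X$ be the set of $P$ satisfying $$\det\begin{bmatrix}p_{11}+p_{12}&a_{11}p_{11}+a_{12}p_{12}\\p_{21}+p_{22}&a_{21}p_{21}+a_{22}p_{22}\end{bmatrix}=\det\begin{bmatrix}p_{11}+p_{21}&b_{11}p_{11}+b_{21}p_{21}\\p_{12}+p_{22}&b_{12}p_{12}+b_{22}p_{22}\end{bmatrix}=0,$$ so that $\mathcal V_X\cap\Delta$ is the curve of dependency equilibria of $X$. Let $E_{ij}$ be the coordinate points (the $2\times2$ matrix units), and let $F_{ij}$ be the following points of $\mathcal V_X$ in the coordinate planes $p_{ij}=0$, given up to a nonzero scalar: $$F_{11}=\begin{bmatrix}0&(a_{12}-a_{21})(b_{21}-b_{22})\\(a_{12}-a_{22})(b_{21}-b_{12})&(a_{12}-a_{21})(b_{12}-b_{21})\end{bmatrix},\quad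 F_{12}=\begin{bmatrix}(a_{11}-a_{22})(b_{21}-b_{22})&0\\(a_{11}-a_{22})(b_{22}-b_{11})&(a_{11}-a_{21})(b_{11}-b_{22})\end{bmatrix},$$ $$F_{21}=\begin{bmatrix}(a_{12}-a_{22})(b_{11}-b_{22})&(a_{11}-a_{22})(b_{22}-b_{11})\\0&(a_{11}-a_{22})(b_{11}-b_{12})\end{bmatrix},\quad F_{22}=\begin{bmatrix}(a_{12}-a_{21})(b_{12}-b_{21})&(a_{11}-a_{21})(b_{21}-b_{12})\\(a_{12}-a_{21})(b_{11}-b_{12})&0\end{bmatrix}.$$ An arc between $P$ and $Q$ is a set of the form $\gamma((0,1))$, where $\gamma$ is a continuous injective map on $[0,1]$ with $\gamma(0)=P$ and $\gamma(1)=Q$. It is an $EE$, $EF$ or $FF$ arc if, respectively, its two endpoints are both among the $E_{ij}$; one is among the $E_{ij}$ and the other among the $F_{ij}$; or both are among the $F_{ij}$. Consider the sign condition $$\operatorname{sign}(a_{11}-a_{21})=\operatorname{sign}(a_{22}-a_{12})\quad\text{and}\quad\operatorname{sign}(b_{11}-b_{12})=\operatorname{sign}(b_{22}-b_{21}).\tag{$*$}$$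 There is a nonzero real polynomial $D$ in the eight payoffs $a_{ij},b_{ij}$ such that the following holds for every game $X$ with $D(X)\neq0$: 1. $\mathcal V_X\cap\Delta$ has $0$, $1$ or $2$ connected components, and each component is an arc between two boundary points of $\Delta$. 2. If $(*)$ holds, then $\mathcal V_X\cap\Delta$ has exactly one component, and it is an $EE$, an $EF$ or an $FF$ arc. 3. If $(*)$ does not hold, then every component of $\mathcal V_X\cap\Delta$ is an $EF$ arc. Moreover, each of the numbers $0$, $1$, $2$ of components in case 3 occurs for generic games: for every $k\in\{0,1,2\}$ and every nonzero real polynomial $G$ in the eight payoffs there is a game $X$ with $G(X)\ne0$ that violates $(*)$ and for which $\mathcal V_X\cap\Delta$ has exactly $k$ connected components. -/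

import Mathlib

namespace Spohn

/-- A `2 × 2` game with real payoffs: `X 0` is the payoff matrix `(a_{ij})` of the first (row)
player, `X 1` is the payoff matrix `(b_{ij})` of the second (column) player.  The indices `1, 2`
of strategies and players are `0, 1 : Fin 2` here. -/
abbrev Game := Fin 2 → Matrix (Fin 2) (Fin 2) ℝ

/-- The open probability simplex `Δ`: positive `2 × 2` matrices whose entries sum to one. -/
def simplex : Set (Matrix (Fin 2) (Fin 2) ℝ) :=
  {P | (∀ i j, 0 < P i j) ∧ ∑ i, ∑ j, P i j = 1}

/-- The boundary points of `Δ`: probability matrices with at least one zero entry. -/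
def simplexBoundary : Set (Matrix (Fin 2) (Fin 2) ℝ) :=
  {P | (∀ i j, 0 ≤ P i j) ∧ ∑ i, ∑ j, P i j = 1 ∧ ∃ i j, P i j = 0}

/-- The matrix `M₁(P)`; its `k`-th row consists of the denominator and the numerator of the
conditional expected payoff of player 1, given that she plays `k`. -/
def M₁ (X : Game) (P : Matrix (Fin 2) (Fin 2) ℝ) : Matrix (Fin 2) (Fin 2) ℝ :=
  Matrix.of fun k => ![∑ j, P k j, ∑ j, X 0 k j * P k j]

/-- The matrix `M₂(P)`, likewise for player 2. -/
def M₂ (X : Game) (P : Matrix (Fin 2) (Fin 2) ℝ) : Matrix (Fin 2) (Fin 2) ℝ :=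
  Matrix.of fun k => ![∑ i, P i k, ∑ i, X 1 i k * P i k]

/-- The (affine cone over the) real Spohn variety `V_X`. -/
def spohnVariety (X : Game) : Set (Matrix (Fin 2) (Fin 2) ℝ) :=
  {P | (M₁ X P).det = 0 ∧ (M₂ X P).det = 0}

/-- The curve `V_X ∩ Δ` of dependency equilibria. -/
def equilibriumCurve (X : Game) : Set (Matrix (Fin 2) (Fin 2) ℝ) :=
  spohnVariety X ∩ simplex

/-- The set of connected components of a subset of a topological space. -/
def components {α : Type*} [TopologicalSpace α] (S : Set α) : Set (Set α) :=
  {C | ∃ x ∈ S, C = connectedComponentIn S x}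

/-- `C` is an arc between `P` and `Q`: there is a simple path from `P` to `Q` that traces out
precisely `C` between its two endpoints. -/
def IsArcBetween {α : Type*} [TopologicalSpace α] (C : Set α) (P Q : α) : Prop :=
  ∃ γ : ℝ → α, ContinuousOn γ (Set.Icc 0 1) ∧ Set.InjOn γ (Set.Icc 0 1) ∧
    γ 0 = P ∧ γ 1 = Q ∧ γ '' Set.Ioo 0 1 = C

/-- The matrices `F_{ij}`, homogeneous coordinates of the unique non-coordinate point of the curve
in the plane `p_{ij} = 0`. -/
def F (X : Game) (i j : Fin 2) : Matrix (Fin 2) (Fin 2) ℝ :=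
  let a := X 0
  let b := X 1
  !![!![0, (a 0 1 - a 1 0) * (b 1 0 - b 1 1);
        (a 0 1 - a 1 1) * (b 1 0 - b 0 1), (a 0 1 - a 1 0) * (b 0 1 - b 1 0)],
     !![(a 0 0 - a 1 1) * (b 1 0 - b 1 1), 0;
        (a 0 0 - a 1 1) * (b 1 1 - b 0 0), (a 0 0 - a 1 0) * (b 0 0 - b 1 1)];
     !![(a 0 1 - a 1 1) * (b 0 0 - b 1 1), (a 0 0 - a 1 1) * (b 1 1 - b 0 0);
        0, (a 0 0 - a 1 1) * (b 0 0 - b 0 1)],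
     !![(a 0 1 - a 1 0) * (b 0 1 - b 1 0), (a 0 0 - a 1 0) * (b 1 0 - b 0 1);
        (a 0 1 - a 1 0) * (b 0 0 - b 0 1), 0]] i j

/-- `P` is one of the coordinate points `E_{ij}`. -/
def IsE (P : Matrix (Fin 2) (Fin 2) ℝ) : Prop :=
  ∃ i j, P = Matrix.single i j 1

/-- `P` represents one of the points `F_{ij}` of projective space. -/
def IsF (X : Game) (P : Matrix (Fin 2) (Fin 2) ℝ) : Prop :=
  ∃ i j, ∃ c : ℝ, c ≠ 0 ∧ P = c • F X i j

/-- An arc between two boundary points of `Δ`. -/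
def IsBoundaryArc (C : Set (Matrix (Fin 2) (Fin 2) ℝ)) : Prop :=
  ∃ P ∈ simplexBoundary, ∃ Q ∈ simplexBoundary, IsArcBetween C P Q

/-- An arc between two of the points `E_{ij}`. -/
def IsEEArc (C : Set (Matrix (Fin 2) (Fin 2) ℝ)) : Prop :=
  ∃ P Q, IsE P ∧ IsE Q ∧ IsArcBetween C P Q

/-- An arc between one of the points `E_{ij}` and one of the points `F_{ij}`. -/
def IsEFArc (X : Game) (C : Set (Matrix (Fin 2) (Fin 2) ℝ)) : Prop :=
  ∃ P Q, IsE P ∧ IsF X Q ∧ IsArcBetween C P Q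

/-- An arc between two of the points `F_{ij}`. -/
def IsFFArc (X : Game) (C : Set (Matrix (Fin 2) (Fin 2) ℝ)) : Prop :=
  ∃ P Q, IsF X P ∧ IsF X Q ∧ IsArcBetween C P Q

/-- The sign condition: `sign(a₁₁ - a₂₁) = sign(a₂₂ - a₁₂)` and
`sign(b₁₁ - b₁₂) = sign(b₂₂ - b₂₁)`. -/
def SignCondition (X : Game) : Prop :=
  SignType.sign (X 0 0 0 - X 0 1 0) = SignType.sign (X 0 1 1 - X 0 0 1) ∧
  SignType.sign (X 1 0 0 - X 1 0 1) = SignType.sign (X 1 1 1 - X 1 1 0)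

/-- A property holds for generic games: it holds outside the zero set of some nonzero polynomial
in the eight payoffs. -/
def ForGeneric (p : Game → Prop) : Prop :=
  ∃ D : MvPolynomial (Fin 2 × Fin 2 × Fin 2) ℝ, D ≠ 0 ∧
    ∀ X : Game, MvPolynomial.eval (fun v => X v.1 v.2.1 v.2.2) D ≠ 0 → p X

/-- A property is possible for generic games: outside the zero set of any nonzero polynomial in the
eight payoffs there is a game that has it. -/
def PossibleForGeneric (p : Game → Prop) : Prop :=
  ∀ D : MvPolynomial (Fin 2 × Fin 2 × Fin 2) ℝ, D ≠ 0 →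
    ∃ X : Game, MvPolynomial.eval (fun v => X v.1 v.2.1 v.2.2) D ≠ 0 ∧ p X

end Spohn

/-! For a matrix `P` of total weight one, the vanishing of the two determinants says that both rows
give the first player the same conditional payoff `v`, and both columns give the second player the
same conditional payoff `w`. For positive `P`, the equation for `v` forces `v` to lie strictly
between the two entries of each row of the payoff matrix (the `overlap`, an open interval or empty),
fixes the proportions inside each row, and so fixes the odds ratio of `P`: `p₁₁ p₂₂ / (p₁₂ p₂₁)`
equals `|v - a₁₂| |v - a₂₁| / (|v - a₁₁| |v - a₂₂|)`. The same holds for `w` with the transposed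
matrix of the second player. Written as a share in `[0, 1]`, so that infinite odds do no harm, this
makes the curve the set of pairs `(v, w)` in the two overlaps with equal `payoffShare`; each pair
determines `P` (`eq_of_rowEq`, `isSolution_solution`), and the parametrization extends continuously
to the closed overlaps.

What remains is the shape of one function of one variable (`overlap_trichotomy`). The share is `0`
at off-diagonal entries and `1` at diagonal ones. If a player meets her half of the sign condition,
her overlap has one end of each kind and the share is a bijection from its closure onto `[0, 1]`.
Otherwise the overlap is empty, or both ends are of the same kind and the share leaves a common end
value `e`, turns once before reaching `1/2`, and returns to `e`.

If one share is bijective and the other overlap is nonempty, inverting the bijective share gives one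
arc. If both shares turn with the same `e`, the one whose turning value is farther from `e` has two
inverse branches over the whole overlap of the other player, hence two arcs. If they turn with
different `e`, the shares lie on opposite sides of `1/2` and the curve is empty. An endpoint of an
arc has share `0` or `1`, so `v` and `w` are entries of the two payoff matrices: it is an `E` point
if they belong to the same cell and an `F` point otherwise. Where the inverted share runs against a
turning one, both endpoints have the same `v` but different `w`, so one is an `E` and the other an
`F`.

Genericity is needed only to keep the entries of each payoff matrix distinct and the two turning
values different; the latter follows from the nonvanishing of a resultant. -/

namespace Spohn

/-! ### Components, arcs and continuous lifts. -/

section Topology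

open Set

variable {α β : Type*} [TopologicalSpace α] [TopologicalSpace β]

theorem components_empty : components (∅ : Set α) = ∅ := by
  ext C
  simp [components]

theorem components_of_isPreconnected {S : Set α} (hS : IsPreconnected S) (hne : S.Nonempty) :
    components S = {S} := by
  obtain ⟨x, hx⟩ := hne
  ext C
  constructor
  · rintro ⟨y, hy, rfl⟩
    exact hS.connectedComponentIn hy
  · rintro rfl
    exact ⟨x, hx, (hS.connectedComponentIn hx).symm⟩

/-- A connected set meeting both parts would, by the intermediate value theorem, contain a point
with `ξ = c`, which neither part does. -/
theorem connectedComponentIn_union_of_separated {C₁ C₂ : Set α} (h₁ : IsPreconnected C₁)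
    {ξ : α → ℝ} (hξ : Continuous ξ) {c : ℝ} (hC₁ : ∀ x ∈ C₁, ξ x < c) (hC₂ : ∀ x ∈ C₂, c < ξ x)
    {x : α} (hx : x ∈ C₁) : connectedComponentIn (C₁ ∪ C₂) x = C₁ := by
  have hxS : x ∈ C₁ ∪ C₂ := Or.inl hx
  apply Subset.antisymm
  · intro y hy
    rcases connectedComponentIn_subset _ _ hy with h | h
    · exact h
    · obtain ⟨z, hz, hzc⟩ := isPreconnected_connectedComponentIn.intermediate_value
        (mem_connectedComponentIn hxS) hy hξ.continuousOn ⟨(hC₁ x hx).le, (hC₂ y h).le⟩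
      rcases connectedComponentIn_subset _ _ hz with h' | h'
      · exact absurd hzc (hC₁ z h').ne
      · exact absurd hzc (hC₂ z h').ne'
  · exact h₁.subset_connectedComponentIn hx subset_union_left

theorem components_union_of_separated {C₁ C₂ : Set α} (h₁ : IsPreconnected C₁)
    (h₂ : IsPreconnected C₂) (n₁ : C₁.Nonempty) (n₂ : C₂.Nonempty)
    {ξ : α → ℝ} (hξ : Continuous ξ) {c : ℝ} (hC₁ : ∀ x ∈ C₁, ξ x < c) (hC₂ : ∀ x ∈ C₂, c < ξ x) :
    components (C₁ ∪ C₂) = {C₁, C₂} ∧ C₁ ≠ C₂ := by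
  have e₁ : ∀ x ∈ C₁, connectedComponentIn (C₁ ∪ C₂) x = C₁ := fun x hx =>
    connectedComponentIn_union_of_separated h₁ hξ hC₁ hC₂ hx
  have e₂ : ∀ x ∈ C₂, connectedComponentIn (C₁ ∪ C₂) x = C₂ := fun x hx => by
    rw [union_comm]
    exact connectedComponentIn_union_of_separated h₂ hξ.neg (c := -c)
      (fun y hy => neg_lt_neg (hC₂ y hy)) (fun y hy => neg_lt_neg (hC₁ y hy)) hx
  obtain ⟨x, hx⟩ := n₁
  obtain ⟨y, hy⟩ := n₂
  refine ⟨?_, ?_⟩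
  · ext C
    constructor
    · rintro ⟨z, hz | hz, rfl⟩
      · exact Or.inl (e₁ z hz)
      · exact Or.inr (e₂ z hz)
    · rintro (rfl | rfl)
      · exact ⟨x, Or.inl hx, (e₁ x hx).symm⟩
      · exact ⟨y, Or.inr hy, (e₂ y hy).symm⟩
  · rintro rfl
    exact lt_asymm (hC₁ x hx) (hC₂ x hx)

theorem IsArcBetween.isPreconnected {C : Set α} {P Q : α} (h : IsArcBetween C P Q) :
    IsPreconnected C := by
  obtain ⟨γ, hc, -, -, -, rfl⟩ := h
  exact isPreconnected_Ioo.image _ (hc.mono Ioo_subset_Icc_self)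

theorem IsArcBetween.nonempty {C : Set α} {P Q : α} (h : IsArcBetween C P Q) : C.Nonempty := by
  obtain ⟨γ, -, -, -, -, rfl⟩ := h
  exact (nonempty_Ioo.2 one_pos).image _

theorem IsArcBetween.image {C : Set α} {P Q : α} (h : IsArcBetween C P Q) {g : α → β}
    (hg : Continuous g) (hg' : Function.Injective g) : IsArcBetween (g '' C) (g P) (g Q) := by
  obtain ⟨γ, hc, hi, rfl, rfl, rfl⟩ := h
  exact ⟨g ∘ γ, hg.comp_continuousOn hc, hg'.injOn.comp hi (mapsTo_univ _ _), rfl, rfl,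
    image_comp _ _ _⟩

/-- A simple path over any nondegenerate interval traces out an arc. -/
theorem isArcBetween_of_Icc {l u : ℝ} (hlu : l < u) {γ : ℝ → α} (hc : ContinuousOn γ (Icc l u))
    (hi : InjOn γ (Icc l u)) : IsArcBetween (γ '' Ioo l u) (γ l) (γ u) := by
  have hd : 0 < u - l := sub_pos.2 hlu
  have hIcc : MapsTo (fun t : ℝ => (u - l) * t + l) (Icc 0 1) (Icc l u) := by
    intro t ht
    constructor
    · nlinarith [ht.1]
    · nlinarith [ht.2]
  refine ⟨γ ∘ fun t => (u - l) * t + l, hc.comp (by fun_prop) hIcc, hi.comp ?_ hIcc, ?_, ?_, ?_⟩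
  · intro s _ t _ hst
    have : (u - l) * s = (u - l) * t := by simpa using hst
    exact mul_left_cancel₀ hd.ne' this
  · simp
  · simp
  · rw [image_comp, image_affine_Ioo hd]
    simp

theorem IsArcBetween.symm {C : Set α} {P Q : α} (h : IsArcBetween C P Q) :
    IsArcBetween C Q P := by
  obtain ⟨γ, hc, hi, rfl, rfl, rfl⟩ := h
  have hIcc : MapsTo (fun t : ℝ => 1 - t) (Icc 0 1) (Icc 0 1) := fun t ht =>
    ⟨sub_nonneg.2 ht.2, sub_le_self _ ht.1⟩
  refine ⟨γ ∘ fun t => 1 - t, hc.comp (by fun_prop) hIcc, hi.comp ?_ hIcc, ?_, ?_, ?_⟩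
  · intro s _ t _ hst
    simpa using hst
  · simp
  · simp
  · rw [image_comp]
    congr 1
    simp

/-- Continuous lifting through a map that is injective and continuous on a compact set. -/
theorem exists_continuousOn_lift {γ : Type*} [TopologicalSpace γ] [T2Space γ] {K : Set α}
    (hK : IsCompact K) {φ : α → γ}
    (hφ : ContinuousOn φ K) (hi : InjOn φ K) {J : Set β} (hJ : J.Nonempty) {ψ : β → γ}
    (hψ : ContinuousOn ψ J) (hsub : ∀ y ∈ J, ψ y ∈ φ '' K) :
    ∃ h : β → α, ContinuousOn h J ∧ MapsTo h J K ∧ ∀ y ∈ J, φ (h y) = ψ y := by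
  classical
  obtain ⟨y₀, hy₀⟩ := hJ
  obtain ⟨x₀, -⟩ := hsub y₀ hy₀
  have : Nonempty α := ⟨x₀⟩
  choose! h hK' hh using hsub
  refine ⟨h, ?_, hK', hh⟩
  have : CompactSpace K := isCompact_iff_compactSpace.1 hK
  -- A continuous injection of a compact space into a Hausdorff space is a closed embedding, so any
  -- choice of preimages is automatically continuous.
  have hemb : Topology.IsClosedEmbedding (K.domRestrict φ) :=
    (continuousOn_iff_continuous_domRestrict.1 hφ).isClosedEmbedding (injOn_iff_injective.1 hi)
  have hcont : Continuous (fun y : J => (⟨h y, hK' y y.2⟩ : K)) := by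
    rw [hemb.isInducing.continuous_iff]
    convert continuousOn_iff_continuous_domRestrict.1 hψ using 1
    ext y
    exact hh y y.2
  exact continuousOn_iff_continuous_domRestrict.2 (continuous_subtype_val.comp hcont)

end Topology

/-! ### The share function of one real variable. -/

section OddsShare

open Set

/-- The share `N / (N + D)` of `N = |v - n₁| |v - n₂|` against `D = |v - d₁| |v - d₂|`. -/
noncomputable def share (n₁ n₂ d₁ d₂ v : ℝ) : ℝ :=
  |v - n₁| * |v - n₂| / (|v - n₁| * |v - n₂| + |v - d₁| * |v - d₂|)

theorem share_comm_left (n₁ n₂ d₁ d₂ : ℝ) : share n₁ n₂ d₁ d₂ = share n₂ n₁ d₁ d₂ := by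
  ext v
  simp only [share, mul_comm |v - n₁|]

theorem share_comm_right (n₁ n₂ d₁ d₂ : ℝ) : share n₁ n₂ d₁ d₂ = share n₁ n₂ d₂ d₁ := by
  ext v
  simp only [share, mul_comm |v - d₁|]

variable {n₁ n₂ d₁ d₂ : ℝ}

theorem share_denominator_pos (h₁₁ : n₁ ≠ d₁) (h₁₂ : n₁ ≠ d₂) (h₂₁ : n₂ ≠ d₁) (h₂₂ : n₂ ≠ d₂)
    (v : ℝ) : 0 < |v - n₁| * |v - n₂| + |v - d₁| * |v - d₂| := by
  have key : ∀ {n d : ℝ}, n ≠ d → v - n = 0 → v - d ≠ 0 := fun h e e' => h (by linarith)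
  by_cases hn : (v - n₁) * (v - n₂) = 0
  · have hd : (v - d₁) * (v - d₂) ≠ 0 := by
      rcases mul_eq_zero.1 hn with e | e
      · exact mul_ne_zero (key h₁₁ e) (key h₁₂ e)
      · exact mul_ne_zero (key h₂₁ e) (key h₂₂ e)
    have := abs_pos.2 hd
    rw [abs_mul] at this
    positivity
  · have := abs_pos.2 hn
    rw [abs_mul] at this
    positivity

theorem continuous_share (h₁₁ : n₁ ≠ d₁) (h₁₂ : n₁ ≠ d₂) (h₂₁ : n₂ ≠ d₁) (h₂₂ : n₂ ≠ d₂) :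
    Continuous (share n₁ n₂ d₁ d₂) := by
  unfold share
  exact Continuous.div (by fun_prop) (by fun_prop)
    fun v => (share_denominator_pos h₁₁ h₁₂ h₂₁ h₂₂ v).ne'

theorem share_swap (h₁₁ : n₁ ≠ d₁) (h₁₂ : n₁ ≠ d₂) (h₂₁ : n₂ ≠ d₁) (h₂₂ : n₂ ≠ d₂) (v : ℝ) :
    share d₁ d₂ n₁ n₂ v = 1 - share n₁ n₂ d₁ d₂ v := by
  have := (share_denominator_pos h₁₁ h₁₂ h₂₁ h₂₂ v).ne'
  rw [share, share, add_comm (|v - d₁| * |v - d₂|), eq_sub_iff_add_eq, ← add_div,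
    div_eq_one_iff_eq this, add_comm]

theorem share_nonneg (n₁ n₂ d₁ d₂ v : ℝ) : 0 ≤ share n₁ n₂ d₁ d₂ v := by
  unfold share
  positivity

theorem share_le_one (n₁ n₂ d₁ d₂ v : ℝ) : share n₁ n₂ d₁ d₂ v ≤ 1 := by
  unfold share
  apply div_le_one_of_le₀ <;> nlinarith [mul_nonneg (abs_nonneg (v - d₁)) (abs_nonneg (v - d₂)),
    mul_nonneg (abs_nonneg (v - n₁)) (abs_nonneg (v - n₂))]

theorem share_eq_zero (h₁₁ : n₁ ≠ d₁) (h₁₂ : n₁ ≠ d₂) (h₂₁ : n₂ ≠ d₁) (h₂₂ : n₂ ≠ d₂) {v : ℝ} :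
    share n₁ n₂ d₁ d₂ v = 0 ↔ v = n₁ ∨ v = n₂ := by
  have := (share_denominator_pos h₁₁ h₁₂ h₂₁ h₂₂ v).ne'
  rw [share, div_eq_zero_iff, or_iff_left this, mul_eq_zero, abs_eq_zero, abs_eq_zero, sub_eq_zero,
    sub_eq_zero]

theorem share_eq_one (h₁₁ : n₁ ≠ d₁) (h₁₂ : n₁ ≠ d₂) (h₂₁ : n₂ ≠ d₁) (h₂₂ : n₂ ≠ d₂) {v : ℝ} :
    share n₁ n₂ d₁ d₂ v = 1 ↔ v = d₁ ∨ v = d₂ := by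
  rw [← share_eq_zero h₁₁.symm h₂₁.symm h₁₂.symm h₂₂.symm, share_swap h₁₁ h₁₂ h₂₁ h₂₂]
  constructor <;> intro h <;> linarith

/-- The odds factor as `(x - l) / |x - d|` times `|x - n| / (u - x)`, and both factors increase on
`[l, u]` because the poles and zeros `n`, `d` lie outside. The two cross-multiplied inequalities are
multiplied, which also covers the end `u`, where the odds are infinite. -/
theorem share_strictMonoOn {l u n d : ℝ} (hlu : l < u) (hn : n < l ∨ u < n) (hd : d < l ∨ u < d)
    (hnd : n ≠ d) : StrictMonoOn (share l n u d) (Icc l u) := by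
  intro x hx y hy hxy
  have hld : l ≠ d := by rintro rfl; rcases hd with h | h <;> linarith
  have hnu : n ≠ u := by rintro rfl; rcases hn with h | h <;> linarith
  have px := share_denominator_pos hlu.ne hld hnu hnd x
  have py := share_denominator_pos hlu.ne hld hnu hnd y
  have h₁ : (x - l) * |y - d| < (y - l) * |x - d| := by
    rcases hd with h | h
    · rw [abs_of_pos (by linarith [hy.1]), abs_of_pos (by linarith [hx.1])]
      nlinarith [mul_pos (sub_pos.2 hxy) (sub_pos.2 h)]
    · rw [abs_of_neg (by linarith [hy.2]), abs_of_neg (by linarith [hx.2])]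
      nlinarith [mul_pos (sub_pos.2 hxy) (sub_pos.2 (hlu.trans h))]
  have h₂ : (u - y) * |x - n| < (u - x) * |y - n| := by
    rcases hn with h | h
    · rw [abs_of_pos (by linarith [hx.1]), abs_of_pos (by linarith [hy.1])]
      nlinarith [mul_pos (sub_pos.2 hxy) (sub_pos.2 (h.trans hlu))]
    · rw [abs_of_neg (by linarith [hx.2]), abs_of_neg (by linarith [hy.2])]
      nlinarith [mul_pos (sub_pos.2 hxy) (sub_pos.2 h)]
  have h := mul_lt_mul'' h₁ h₂ (mul_nonneg (sub_nonneg.2 hx.1) (abs_nonneg _))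
    (mul_nonneg (sub_nonneg.2 hy.2) (abs_nonneg _))
  have e : ∀ w ∈ Icc l u, |w - l| = w - l ∧ |w - u| = u - w := fun w hw =>
    ⟨abs_of_nonneg (sub_nonneg.2 hw.1), by rw [abs_sub_comm, abs_of_nonneg (sub_nonneg.2 hw.2)]⟩
  rw [(e x hx).1, (e x hx).2] at px
  rw [(e y hy).1, (e y hy).2] at py
  rw [share, share, (e x hx).1, (e x hx).2, (e y hy).1, (e y hy).2, div_lt_div_iff₀ px py]
  nlinarith [h]

theorem share_strictAntiOn {l u n d : ℝ} (hlu : l < u) (hn : n < l ∨ u < n) (hd : d < l ∨ u < d)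
    (hnd : n ≠ d) : StrictAntiOn (share u n l d) (Icc l u) := by
  have hud : u ≠ d := by rintro rfl; rcases hd with h | h <;> linarith
  have hnl : n ≠ l := by rintro rfl; rcases hn with h | h <;> linarith
  intro x hx y hy hxy
  have := share_strictMonoOn hlu hd hn hnd.symm hx hy hxy
  rw [share_swap hlu.ne' hud hnl hnd, share_swap hlu.ne' hud hnl hnd] at this
  linarith

/-- Up to sign, the discriminant of `(1 - c) (v - n₁) (v - n₂) - c (v - d₁) (v - d₂)` in `v`. -/
def shareDiscr (n₁ n₂ d₁ d₂ c : ℝ) : ℝ :=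
  (n₁ - n₂) ^ 2 * (1 - c) ^ 2 -
    (2 * (n₁ + n₂) * (d₁ + d₂) - 4 * n₁ * n₂ - 4 * d₁ * d₂) * ((1 - c) * c) + (d₁ - d₂) ^ 2 * c ^ 2

/-- The condition `c ≤ share v` is a quadratic inequality `0 ≤ q v` with leading coefficient `-(1 -
2c)`. All shares here are below `1/2`, so for the relevant `c` the quadratic is strictly concave and
the share is strictly quasiconcave: it rises to a unique maximum and then falls. At the maximal
level `q` has a double root, hence zero discriminant. -/
theorem share_unimodal {l u : ℝ} (hl : d₁ < l) (hlu : l < u) (hu : u < d₂) :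
    ∃ m, l < m ∧ m < u ∧ InjOn (share l u d₁ d₂) (Icc l m) ∧ InjOn (share l u d₁ d₂) (Icc m u) ∧
      0 < share l u d₁ d₂ m ∧ share l u d₁ d₂ m < 1 / 2 ∧
      (∀ v ∈ Icc l u, share l u d₁ d₂ v ≤ share l u d₁ d₂ m) ∧
      shareDiscr l u d₁ d₂ (share l u d₁ d₂ m) = 0 := by
  have n₁₁ : l ≠ d₁ := hl.ne'
  have n₁₂ : l ≠ d₂ := (hlu.trans hu).ne
  have n₂₁ : u ≠ d₁ := (hl.trans hlu).ne'
  have n₂₂ : u ≠ d₂ := hu.ne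
  set φ := share l u d₁ d₂ with hφ
  have hcont : Continuous φ := continuous_share n₁₁ n₁₂ n₂₁ n₂₂
  have eq : ∀ v ∈ Icc l u, φ v = (v - l) * (u - v) / ((v - l) * (u - v) + (v - d₁) * (d₂ - v)) ∧
      0 < (v - l) * (u - v) + (v - d₁) * (d₂ - v) := by
    intro v hv
    have e₁ : |v - l| = v - l := abs_of_nonneg (sub_nonneg.2 hv.1)
    have e₂ : |v - u| = u - v := by rw [abs_sub_comm, abs_of_nonneg (sub_nonneg.2 hv.2)]
    have e₃ : |v - d₁| = v - d₁ := abs_of_nonneg (by linarith [hv.1])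
    have e₄ : |v - d₂| = d₂ - v := by rw [abs_sub_comm, abs_of_nonneg (by linarith [hv.2])]
    have := share_denominator_pos n₁₁ n₁₂ n₂₁ n₂₂ v
    rw [e₁, e₂, e₃, e₄] at this
    exact ⟨by rw [hφ, share, e₁, e₂, e₃, e₄], this⟩
  have le_iff : ∀ c, ∀ v ∈ Icc l u,
      c ≤ φ v ↔ 0 ≤ (1 - c) * ((v - l) * (u - v)) - c * ((v - d₁) * (d₂ - v)) := by
    intro c v hv
    rw [(eq v hv).1, le_div_iff₀ (eq v hv).2]
    constructor <;> intro h <;> linarith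
  have half : ∀ v ∈ Icc l u, φ v < 1 / 2 := by
    intro v hv
    rw [(eq v hv).1, div_lt_iff₀ (eq v hv).2]
    nlinarith [mul_pos (sub_pos.2 hl) (sub_pos.2 hu),
      mul_nonneg (sub_nonneg.2 hv.1) (sub_pos.2 hu).le, mul_nonneg (sub_nonneg.2 hv.2) (sub_pos.2 hl).le]
  have concave : ∀ x ∈ Icc l u, ∀ y ∈ Icc l u, ∀ z, x < z → z < y → ∀ c, c ≤ φ x → c ≤ φ y →
      c < φ z := by
    intro x hx y hy z hxz hzy c hcx hcy
    have hz : z ∈ Icc l u := ⟨hx.1.trans hxz.le, hzy.le.trans hy.2⟩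
    have hc : c < 1 / 2 := hcx.trans_lt (half x hx)
    rw [le_iff c x hx] at hcx
    rw [le_iff c y hy] at hcy
    rw [(eq z hz).1, lt_div_iff₀ (eq z hz).2]
    -- This is the concavity defect: `(y - x) q(z) = (y - z) q(x) + (z - x) q(y) + (1 - 2c) (z - x)
    -- (y - z) (y - x)` for the quadratic `q` of level `c`.
    have hpos : 0 < (1 - 2 * c) * ((z - x) * (y - z) * (y - x)) := by
      apply mul_pos (by linarith)
      exact mul_pos (mul_pos (by linarith) (by linarith)) (by linarith)
    have key : 0 < (y - x) * ((1 - c) * ((z - l) * (u - z)) - c * ((z - d₁) * (d₂ - z))) := by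
      nlinarith [mul_nonneg hcx (sub_pos.2 hzy).le, mul_nonneg hcy (sub_pos.2 hxz).le]
    have := pos_of_mul_pos_right key (by linarith : (0 : ℝ) ≤ y - x)
    linarith
  obtain ⟨m, hm, hmax⟩ := isCompact_Icc.exists_isMaxOn (nonempty_Icc.2 hlu.le) hcont.continuousOn
  have hmax' : ∀ v ∈ Icc l u, φ v ≤ φ m := fun v hv => hmax hv
  have hl0 : φ l = 0 := (share_eq_zero n₁₁ n₁₂ n₂₁ n₂₂).2 (Or.inl rfl)
  have hu0 : φ u = 0 := (share_eq_zero n₁₁ n₁₂ n₂₁ n₂₂).2 (Or.inr rfl)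
  have hlmem : l ∈ Icc l u := left_mem_Icc.2 hlu.le
  have humem : u ∈ Icc l u := right_mem_Icc.2 hlu.le
  have hpos : 0 < φ m := by
    refine (concave l hlmem u humem ((l + u) / 2) (by linarith) (by linarith) 0
      hl0.ge hu0.ge).trans_le
      (hmax' _ ⟨by linarith, by linarith⟩)
  have hlm : l < m := lt_of_le_of_ne hm.1 (by rintro rfl; linarith)
  have hmu : m < u := lt_of_le_of_ne hm.2 (by rintro rfl; linarith)
  have ltmax : ∀ x ∈ Icc l u, x ≠ m → φ x < φ m := by
    intro x hx hxm
    refine lt_of_le_of_ne (hmax' x hx) fun e => ?_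
    rcases lt_or_gt_of_ne hxm with h | h
    · have := concave x hx m hm ((x + m) / 2) (by linarith) (by linarith) _ e.ge le_rfl
      exact this.not_ge (hmax' _ ⟨by linarith [hx.1, hm.1], by linarith [hx.2, hm.2]⟩)
    · have := concave m hm x hx ((x + m) / 2) (by linarith) (by linarith) _ le_rfl e.ge
      exact this.not_ge (hmax' _ ⟨by linarith [hx.1, hm.1], by linarith [hx.2, hm.2]⟩)
  refine ⟨m, hlm, hmu, StrictMonoOn.injOn ?_, StrictAntiOn.injOn ?_, hpos, half m hm, hmax', ?_⟩
  · intro x hx y hy hxy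
    have hx' : x ∈ Icc l u := ⟨hx.1, hx.2.trans hm.2⟩
    rcases hy.2.lt_or_eq with h | rfl
    · exact concave x hx' m hm y hxy h _ le_rfl (hmax' x hx')
    · exact ltmax x hx' hxy.ne
  · intro x hx y hy hxy
    have hy' : y ∈ Icc l u := ⟨hm.1.trans hy.1, hy.2⟩
    rcases hx.1.lt_or_eq with h | rfl
    · exact concave m hm y hy' x h hxy _ (hmax' y hy') le_rfl
    · exact ltmax y hy' hxy.ne'
  · set c := φ m with hc
    let q : ℝ → ℝ := fun v => (1 - c) * ((v - l) * (u - v)) - c * ((v - d₁) * (d₂ - v))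
    have hqm : q m = 0 := by
      have h := (eq m hm).1
      rw [← hc, eq_div_iff (eq m hm).2.ne'] at h
      simp only [q]
      linarith
    have hloc : IsLocalMax q m := by
      filter_upwards [Icc_mem_nhds hlm hmu] with v hv
      rw [hqm]
      by_contra! hlt
      have hv' : 0 < (1 - c) * ((v - l) * (u - v)) - c * ((v - d₁) * (d₂ - v)) := hlt
      have : c < φ v := by
        rw [(eq v hv).1, lt_div_iff₀ (eq v hv).2]
        linarith
      exact this.not_ge (hmax' v hv)
    have hder : HasDerivAt q ((1 - c) * (1 * (u - m) + (m - l) * (-1)) -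
        c * (1 * (d₂ - m) + (m - d₁) * (-1))) m := by
      have h₁ := ((hasDerivAt_id m).sub_const l).mul ((hasDerivAt_id m).const_sub u)
      have h₂ := ((hasDerivAt_id m).sub_const d₁).mul ((hasDerivAt_id m).const_sub d₂)
      exact (h₁.const_mul (1 - c)).sub (h₂.const_mul c)
    have h0 := hloc.hasDerivAt_eq_zero hder
    have hqm' : (1 - c) * ((m - l) * (u - m)) - c * ((m - d₁) * (d₂ - m)) = 0 := hqm
    unfold shareDiscr
    -- The discriminant is `q'(m)² + 4 (1 - 2c) q(m)`, and both `q` and `q'` vanish at `m`.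
    linear_combination ((1 - c) * (1 * (u - m) + (m - l) * (-1)) -
        c * (1 * (d₂ - m) + (m - d₁) * (-1))) * h0 + 4 * (1 - 2 * c) * hqm'

theorem share_unimodal_swap {l u : ℝ} (hl : n₁ < l) (hlu : l < u) (hu : u < n₂) :
    ∃ m, l < m ∧ m < u ∧ InjOn (share n₁ n₂ l u) (Icc l m) ∧ InjOn (share n₁ n₂ l u) (Icc m u) ∧
      1 / 2 < share n₁ n₂ l u m ∧ share n₁ n₂ l u m < 1 ∧
      (∀ v ∈ Icc l u, share n₁ n₂ l u m ≤ share n₁ n₂ l u v) ∧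
      shareDiscr n₁ n₂ l u (share n₁ n₂ l u m) = 0 := by
  obtain ⟨m, h₁, h₂, h₃, h₄, h₅, h₆, h₇, h₈⟩ := share_unimodal hl hlu hu
  have e : ∀ v, share n₁ n₂ l u v = 1 - share l u n₁ n₂ v :=
    share_swap hl.ne' (hlu.trans hu).ne (hl.trans hlu).ne' hu.ne
  refine ⟨m, h₁, h₂, ?_, ?_, ?_, ?_, ?_, ?_⟩
  · intro x hx y hy h
    rw [e, e] at h
    exact h₃ hx hy (by linarith)
  · intro x hx y hy h
    rw [e, e] at h
    exact h₄ hx hy (by linarith)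
  · rw [e]; linarith
  · rw [e]; linarith
  · intro v hv
    rw [e, e]
    linarith [h₇ v hv]
  · rw [← h₈, e]
    unfold shareDiscr
    ring

end OddsShare

/-! ### The payoff share of one player on her overlap. -/

section OnePlayer

open Set

/-- The payoff values that are attained by a totally mixed reply in both rows of `A`. -/
def overlap (A : Matrix (Fin 2) (Fin 2) ℝ) : Set ℝ :=
  {v | 0 < (v - A 0 1) * (A 0 0 - v) ∧ 0 < (v - A 1 1) * (A 1 0 - v)}

/-- The odds share that row `A` forces at payoff value `v`: the value of
`p₁₁ p₂₂ / (p₁₁ p₂₂ + p₁₂ p₂₁)`. -/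
noncomputable def payoffShare (A : Matrix (Fin 2) (Fin 2) ℝ) (v : ℝ) : ℝ :=
  share (A 0 1) (A 1 0) (A 0 0) (A 1 1) v

/-- All entries of `A` are different. -/
structure DistinctEntries (A : Matrix (Fin 2) (Fin 2) ℝ) : Prop where
  h00_01 : A 0 0 ≠ A 0 1
  h00_10 : A 0 0 ≠ A 1 0
  h00_11 : A 0 0 ≠ A 1 1
  h01_10 : A 0 1 ≠ A 1 0
  h01_11 : A 0 1 ≠ A 1 1
  h10_11 : A 1 0 ≠ A 1 1

/-- `A` has overlap `(l, u)`, and `payoffShare A` runs injectively between `0` and `1` on it. -/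
structure MonotoneOverlap (A : Matrix (Fin 2) (Fin 2) ℝ) (l u : ℝ) : Prop where
  lt : l < u
  overlap_eq : overlap A = Ioo l u
  injOn : InjOn (payoffShare A) (Icc l u)
  ends : payoffShare A l = 0 ∧ payoffShare A u = 1 ∨ payoffShare A l = 1 ∧ payoffShare A u = 0

/-- `A` has overlap `(l, u)`, and `payoffShare A` has the same value `e` at both of its ends and
turns once, at `m`. -/
structure TurningOverlap (A : Matrix (Fin 2) (Fin 2) ℝ) (e l u m : ℝ) : Prop where
  left_lt : l < m
  lt_right : m < u
  overlap_eq : overlap A = Ioo l u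
  injOn_left : InjOn (payoffShare A) (Icc l m)
  injOn_right : InjOn (payoffShare A) (Icc m u)
  apply_left : payoffShare A l = e
  apply_right : payoffShare A u = e
  bounds : (e = 0 ∧ 0 < payoffShare A m ∧ payoffShare A m < 1 / 2 ∧
      ∀ v ∈ Icc l u, payoffShare A v ≤ payoffShare A m) ∨
    (e = 1 ∧ 1 / 2 < payoffShare A m ∧ payoffShare A m < 1 ∧
      ∀ v ∈ Icc l u, payoffShare A m ≤ payoffShare A v)
  discr_eq : shareDiscr (A 0 1) (A 1 0) (A 0 0) (A 1 1) (payoffShare A m) = 0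

variable {A : Matrix (Fin 2) (Fin 2) ℝ}

theorem DistinctEntries.continuous_payoffShare (hA : DistinctEntries A) :
    Continuous (payoffShare A) :=
  continuous_share hA.h00_01.symm hA.h01_11 hA.h00_10.symm hA.h10_11

theorem DistinctEntries.payoffShare_eq_zero (hA : DistinctEntries A) {v : ℝ} :
    payoffShare A v = 0 ↔ v = A 0 1 ∨ v = A 1 0 :=
  share_eq_zero hA.h00_01.symm hA.h01_11 hA.h00_10.symm hA.h10_11

theorem DistinctEntries.payoffShare_eq_one (hA : DistinctEntries A) {v : ℝ} :
    payoffShare A v = 1 ↔ v = A 0 0 ∨ v = A 1 1 :=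
  share_eq_one hA.h00_01.symm hA.h01_11 hA.h00_10.symm hA.h10_11

theorem mul_sub_pos_iff {a b v : ℝ} (h : a < b) : 0 < (v - a) * (b - v) ↔ a < v ∧ v < b := by
  rw [mul_pos_iff, sub_pos, sub_pos, sub_neg, sub_neg]
  constructor
  · rintro (h' | h')
    · exact h'
    · linarith
  · exact Or.inl

theorem mul_sub_pos_iff' {a b v : ℝ} (h : b < a) : 0 < (v - a) * (b - v) ↔ b < v ∧ v < a := by
  rw [← mul_sub_pos_iff h, show (v - a) * (b - v) = (v - b) * (a - v) by ring]

theorem overlap_eq_Ioo (hA : DistinctEntries A) :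
    overlap A = Ioo (max (min (A 0 0) (A 0 1)) (min (A 1 0) (A 1 1)))
      (min (max (A 0 0) (A 0 1)) (max (A 1 0) (A 1 1))) := by
  ext v
  simp only [overlap, mem_ofPred_eq, mem_Ioo, max_lt_iff, lt_min_iff]
  rcases lt_or_gt_of_ne hA.h00_01 with h | h <;> rcases lt_or_gt_of_ne hA.h10_11 with h' | h'
  · rw [mul_sub_pos_iff' h, mul_sub_pos_iff' h', min_eq_left h.le, max_eq_right h.le,
      min_eq_left h'.le, max_eq_right h'.le]
    tauto
  · rw [mul_sub_pos_iff' h, mul_sub_pos_iff h', min_eq_left h.le, max_eq_right h.le,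
      min_eq_right h'.le, max_eq_left h'.le]
    tauto
  · rw [mul_sub_pos_iff h, mul_sub_pos_iff' h', min_eq_right h.le, max_eq_left h.le,
      min_eq_left h'.le, max_eq_right h'.le]
    tauto
  · rw [mul_sub_pos_iff h, mul_sub_pos_iff h', min_eq_right h.le, max_eq_left h.le,
      min_eq_right h'.le, max_eq_left h'.le]
    tauto

/-- Payoff shares over an interval whose lower end is off-diagonal and whose upper end is diagonal,
or vice versa. -/
theorem monotoneOverlap_of_ends {l u n d : ℝ} (hlu : l < u)
    (h : overlap A = Ioo l u) (hn : n < l ∨ u < n) (hd : d < l ∨ u < d)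
    (hs : payoffShare A = share l n u d ∨ payoffShare A = share u n l d) (hnd : n ≠ d) :
    MonotoneOverlap A l u := by
  have hld : l ≠ d := by rintro rfl; rcases hd with h | h <;> linarith
  have hnu : n ≠ u := by rintro rfl; rcases hn with h | h <;> linarith
  have hud : u ≠ d := by rintro rfl; rcases hd with h | h <;> linarith
  have hnl : n ≠ l := by rintro rfl; rcases hn with h | h <;> linarith
  rcases hs with hs | hs
  · refine ⟨hlu, h, ?_, Or.inl ⟨?_, ?_⟩⟩
    · rw [hs]
      exact (share_strictMonoOn hlu hn hd hnd).injOn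
    · rw [hs, share_eq_zero hlu.ne hld hnu hnd]
      exact Or.inl rfl
    · rw [hs, share_eq_one hlu.ne hld hnu hnd]
      exact Or.inl rfl
  · refine ⟨hlu, h, ?_, Or.inr ⟨?_, ?_⟩⟩
    · rw [hs]
      exact (share_strictAntiOn hlu hn hd hnd).injOn
    · rw [hs, share_eq_one hlu.ne' hud hnl hnd]
      exact Or.inl rfl
    · rw [hs, share_eq_zero hlu.ne' hud hnl hnd]
      exact Or.inl rfl

theorem exists_turningOverlap_zero {l u d₁ d₂ : ℝ} (h₁ : d₁ < l) (hlu : l < u)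
    (h₂ : u < d₂) (h : overlap A = Ioo l u) (hs : payoffShare A = share l u d₁ d₂)
    (hd : ∀ c, shareDiscr (A 0 1) (A 1 0) (A 0 0) (A 1 1) c = shareDiscr l u d₁ d₂ c) :
    ∃ m, TurningOverlap A 0 l u m := by
  obtain ⟨m, hl, hu, i₁, i₂, hpos, hlt, hmax, hdisc⟩ := share_unimodal h₁ hlu h₂
  refine ⟨m, hl, hu, h, hs ▸ i₁, hs ▸ i₂, ?_, ?_, Or.inl ⟨rfl, hs ▸ hpos, hs ▸ hlt, hs ▸ hmax⟩, ?_⟩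
  · rw [hs, share_eq_zero h₁.ne' (hlu.trans h₂).ne (h₁.trans hlu).ne' h₂.ne]
    exact Or.inl rfl
  · rw [hs, share_eq_zero h₁.ne' (hlu.trans h₂).ne (h₁.trans hlu).ne' h₂.ne]
    exact Or.inr rfl
  · rw [hd, hs, hdisc]

theorem exists_turningOverlap_one {l u n₁ n₂ : ℝ} (h₁ : n₁ < l) (hlu : l < u)
    (h₂ : u < n₂) (h : overlap A = Ioo l u) (hs : payoffShare A = share n₁ n₂ l u)
    (hd : ∀ c, shareDiscr (A 0 1) (A 1 0) (A 0 0) (A 1 1) c = shareDiscr n₁ n₂ l u c) :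
    ∃ m, TurningOverlap A 1 l u m := by
  obtain ⟨m, hl, hu, i₁, i₂, hpos, hlt, hmin, hdisc⟩ := share_unimodal_swap h₁ hlu h₂
  refine ⟨m, hl, hu, h, hs ▸ i₁, hs ▸ i₂, ?_, ?_, Or.inr ⟨rfl, hs ▸ hpos, hs ▸ hlt, hs ▸ hmin⟩, ?_⟩
  · rw [hs, share_eq_one h₁.ne (h₁.trans hlu).ne (hlu.trans h₂).ne' h₂.ne']
    exact Or.inl rfl
  · rw [hs, share_eq_one h₁.ne (h₁.trans hlu).ne (hlu.trans h₂).ne' h₂.ne']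
    exact Or.inr rfl
  · rw [hd, hs, hdisc]

theorem exists_turningOverlap_zero_of_lt (hA : DistinctEntries A) (h₁ : A 1 1 < A 0 1)
    (h₂ : A 0 1 < A 1 0) (h₃ : A 1 0 < A 0 0) : ∃ m, TurningOverlap A 0 (A 0 1) (A 1 0) m := by
  refine exists_turningOverlap_zero h₁ h₂ h₃ ?_ (share_comm_right _ _ _ _) fun c => ?_
  · rw [overlap_eq_Ioo hA]
    simp only [min_eq_right, max_eq_left, (h₂.trans h₃).le, (h₁.trans h₂).le, h₁.le, h₃.le]
  · unfold shareDiscr; ring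

/-- The part of the sign condition that concerns the player with payoffs `A`. -/
def Coordinating (A : Matrix (Fin 2) (Fin 2) ℝ) : Prop :=
  0 < (A 0 0 - A 1 0) * (A 1 1 - A 0 1)

set_option linter.unusedSimpArgs false in
-- The overlap is the intersection of the intervals spanned by the two rows, so its shape depends
-- only on the order of the entries. Ends of different kinds, diagonal and off-diagonal, give a
-- monotone share; ends of the same kind have the two remaining entries on either side and give a
-- turning one.
theorem overlap_trichotomy (hA : DistinctEntries A) :
    (overlap A = ∅ ∧ ¬ Coordinating A) ∨ (Coordinating A ∧ ∃ l u, MonotoneOverlap A l u) ∨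
      (¬ Coordinating A ∧ ∃ e l u m, TurningOverlap A e l u m) := by
  have hs : payoffShare A = share (A 0 1) (A 1 0) (A 0 0) (A 1 1) := rfl
  have hs₁ := hs.trans (share_comm_left _ _ _ _)
  have hs₂ := hs.trans (share_comm_right _ _ _ _)
  have hs₃ := hs₁.trans (share_comm_right _ _ _ _)
  have pp : A 1 0 < A 0 0 → A 0 1 < A 1 1 → Coordinating A := fun h h' =>
    mul_pos (sub_pos.2 h) (sub_pos.2 h')
  have nn : A 0 0 < A 1 0 → A 1 1 < A 0 1 → Coordinating A := fun h h' =>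
    mul_pos_of_neg_of_neg (sub_neg.2 h) (sub_neg.2 h')
  have pn : A 1 0 < A 0 0 → A 1 1 < A 0 1 → ¬ Coordinating A := fun h h' =>
    (mul_neg_of_pos_of_neg (sub_pos.2 h) (sub_neg.2 h')).not_gt
  have np : A 0 0 < A 1 0 → A 0 1 < A 1 1 → ¬ Coordinating A := fun h h' =>
    (mul_neg_of_neg_of_pos (sub_neg.2 h) (sub_pos.2 h')).not_gt
  have ho := overlap_eq_Ioo hA
  have emp : ∀ {l u : ℝ}, u ≤ l → Ioo l u = ∅ := fun h => Ioo_eq_empty h.not_gt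
  -- The order within each row is settled here; in each of the four cases the lower ends and then
  -- the upper ends of the two row intervals are compared, which determines the ends of the overlap.
  rcases lt_or_gt_of_ne hA.h00_01 with h | h <;> rcases lt_or_gt_of_ne hA.h10_11 with h' | h'
  · rcases lt_or_gt_of_ne hA.h00_10 with h₁ | h₁ <;> rcases lt_or_gt_of_ne hA.h01_11 with h₂ | h₂
    · have hO : overlap A = Ioo (A 1 0) (A 0 1) := by
        rw [ho]
        simp only [min_eq_left, min_eq_right, max_eq_left, max_eq_right, h.le, h'.le, h₁.le, h₂.le]
      rcases lt_or_ge (A 1 0) (A 0 1) with h₀ | h₀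
      · obtain ⟨m, hm⟩ := exists_turningOverlap_zero (d₁ := A 0 0)
          (d₂ := A 1 1) (by linarith) h₀ (by linarith) hO hs₁
          fun c => by unfold shareDiscr; ring
        exact Or.inr (Or.inr ⟨np (by linarith) (by linarith), _, _, _, m, hm⟩)
      · have h₃ := lt_of_le_of_ne h₀ hA.h01_10
        exact Or.inl ⟨hO.trans (emp h₀), np (by linarith) (by linarith)⟩
    · have hO : overlap A = Ioo (A 1 0) (A 1 1) := by
        rw [ho]
        simp only [min_eq_left, min_eq_right, max_eq_left, max_eq_right, h.le, h'.le, h₁.le, h₂.le]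
      exact Or.inr (Or.inl ⟨nn (by linarith) (by linarith), _, _,
        monotoneOverlap_of_ends (n := A 0 1) (d := A 0 0) (by linarith) hO
          (Or.inr (by linarith)) (Or.inl (by linarith))
          (Or.inl hs₃) hA.h00_01.symm⟩)
    · have hO : overlap A = Ioo (A 0 0) (A 0 1) := by
        rw [ho]
        simp only [min_eq_left, min_eq_right, max_eq_left, max_eq_right, h.le, h'.le, h₁.le, h₂.le]
      exact Or.inr (Or.inl ⟨pp (by linarith) (by linarith), _, _,
        monotoneOverlap_of_ends (n := A 1 0) (d := A 1 1) (by linarith) hO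
          (Or.inl (by linarith)) (Or.inr (by linarith))
          (Or.inr hs) hA.h10_11⟩)
    · have hO : overlap A = Ioo (A 0 0) (A 1 1) := by
        rw [ho]
        simp only [min_eq_left, min_eq_right, max_eq_left, max_eq_right, h.le, h'.le, h₁.le, h₂.le]
      rcases lt_or_ge (A 0 0) (A 1 1) with h₀ | h₀
      · obtain ⟨m, hm⟩ := exists_turningOverlap_one (n₁ := A 1 0)
          (n₂ := A 0 1) (by linarith) h₀ (by linarith) hO hs₁
          fun c => by unfold shareDiscr; ring
        exact Or.inr (Or.inr ⟨pn (by linarith) (by linarith), _, _, _, m, hm⟩)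
      · have h₃ := lt_of_le_of_ne h₀ hA.h00_11.symm
        exact Or.inl ⟨hO.trans (emp h₀), pn (by linarith) (by linarith)⟩
  · rcases lt_or_gt_of_ne hA.h00_11 with h₁ | h₁ <;> rcases lt_or_gt_of_ne hA.h01_10 with h₂ | h₂
    · have hO : overlap A = Ioo (A 1 1) (A 0 1) := by
        rw [ho]
        simp only [min_eq_left, min_eq_right, max_eq_left, max_eq_right, h.le, h'.le, h₁.le, h₂.le]
      rcases lt_or_ge (A 1 1) (A 0 1) with h₀ | h₀
      · exact Or.inr (Or.inl ⟨nn (by linarith) (by linarith), _, _,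
          monotoneOverlap_of_ends (n := A 1 0) (d := A 0 0) (by linarith) hO
            (Or.inr (by linarith)) (Or.inl (by linarith))
            (Or.inr hs₂) hA.h00_10.symm⟩)
      · have h₃ := lt_of_le_of_ne h₀ hA.h01_11
        exact Or.inl ⟨hO.trans (emp h₀), np (by linarith) (by linarith)⟩
    · have hO : overlap A = Ioo (A 1 1) (A 1 0) := by
        rw [ho]
        simp only [min_eq_left, min_eq_right, max_eq_left, max_eq_right, h.le, h'.le, h₁.le, h₂.le]
      exact Or.inr (Or.inl ⟨nn (by linarith) (by linarith), _, _,
        monotoneOverlap_of_ends (n := A 0 1) (d := A 0 0) (by linarith) hO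
          (Or.inr (by linarith)) (Or.inl (by linarith))
          (Or.inr hs₃) hA.h00_01.symm⟩)
    · have hO : overlap A = Ioo (A 0 0) (A 0 1) := by
        rw [ho]
        simp only [min_eq_left, min_eq_right, max_eq_left, max_eq_right, h.le, h'.le, h₁.le, h₂.le]
      exact Or.inr (Or.inl ⟨nn (by linarith) (by linarith), _, _,
        monotoneOverlap_of_ends (n := A 1 0) (d := A 1 1) (by linarith) hO
          (Or.inr (by linarith)) (Or.inl (by linarith))
          (Or.inr hs) hA.h10_11⟩)
    · have hO : overlap A = Ioo (A 0 0) (A 1 0) := by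
        rw [ho]
        simp only [min_eq_left, min_eq_right, max_eq_left, max_eq_right, h.le, h'.le, h₁.le, h₂.le]
      rcases lt_or_ge (A 0 0) (A 1 0) with h₀ | h₀
      · exact Or.inr (Or.inl ⟨nn (by linarith) (by linarith), _, _,
          monotoneOverlap_of_ends (n := A 0 1) (d := A 1 1) (by linarith) hO
            (Or.inr (by linarith)) (Or.inl (by linarith))
            (Or.inr hs₁) hA.h01_11⟩)
      · have h₃ := lt_of_le_of_ne h₀ hA.h00_10.symm
        exact Or.inl ⟨hO.trans (emp h₀), pn (by linarith) (by linarith)⟩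
  · rcases lt_or_gt_of_ne hA.h01_10 with h₁ | h₁ <;> rcases lt_or_gt_of_ne hA.h00_11 with h₂ | h₂
    · have hO : overlap A = Ioo (A 1 0) (A 0 0) := by
        rw [ho]
        simp only [min_eq_left, min_eq_right, max_eq_left, max_eq_right, h.le, h'.le, h₁.le, h₂.le]
      rcases lt_or_ge (A 1 0) (A 0 0) with h₀ | h₀
      · exact Or.inr (Or.inl ⟨pp (by linarith) (by linarith), _, _,
          monotoneOverlap_of_ends (n := A 0 1) (d := A 1 1) (by linarith) hO
            (Or.inl (by linarith)) (Or.inr (by linarith))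
            (Or.inl hs₁) hA.h01_11⟩)
      · have h₃ := lt_of_le_of_ne h₀ hA.h00_10
        exact Or.inl ⟨hO.trans (emp h₀), np (by linarith) (by linarith)⟩
    · have hO : overlap A = Ioo (A 1 0) (A 1 1) := by
        rw [ho]
        simp only [min_eq_left, min_eq_right, max_eq_left, max_eq_right, h.le, h'.le, h₁.le, h₂.le]
      exact Or.inr (Or.inl ⟨pp (by linarith) (by linarith), _, _,
        monotoneOverlap_of_ends (n := A 0 1) (d := A 0 0) (by linarith) hO
          (Or.inl (by linarith)) (Or.inr (by linarith))
          (Or.inl hs₃) hA.h00_01.symm⟩)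
    · have hO : overlap A = Ioo (A 0 1) (A 0 0) := by
        rw [ho]
        simp only [min_eq_left, min_eq_right, max_eq_left, max_eq_right, h.le, h'.le, h₁.le, h₂.le]
      exact Or.inr (Or.inl ⟨pp (by linarith) (by linarith), _, _,
        monotoneOverlap_of_ends (n := A 1 0) (d := A 1 1) (by linarith) hO
          (Or.inl (by linarith)) (Or.inr (by linarith))
          (Or.inl hs) hA.h10_11⟩)
    · have hO : overlap A = Ioo (A 0 1) (A 1 1) := by
        rw [ho]
        simp only [min_eq_left, min_eq_right, max_eq_left, max_eq_right, h.le, h'.le, h₁.le, h₂.le]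
      rcases lt_or_ge (A 0 1) (A 1 1) with h₀ | h₀
      · exact Or.inr (Or.inl ⟨pp (by linarith) (by linarith), _, _,
          monotoneOverlap_of_ends (n := A 1 0) (d := A 0 0) (by linarith) hO
            (Or.inl (by linarith)) (Or.inr (by linarith))
            (Or.inl hs₂) hA.h00_10.symm⟩)
      · have h₃ := lt_of_le_of_ne h₀ hA.h01_11.symm
        exact Or.inl ⟨hO.trans (emp h₀), pn (by linarith) (by linarith)⟩
  · rcases lt_or_gt_of_ne hA.h01_11 with h₁ | h₁ <;> rcases lt_or_gt_of_ne hA.h00_10 with h₂ | h₂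
    · have hO : overlap A = Ioo (A 1 1) (A 0 0) := by
        rw [ho]
        simp only [min_eq_left, min_eq_right, max_eq_left, max_eq_right, h.le, h'.le, h₁.le, h₂.le]
      rcases lt_or_ge (A 1 1) (A 0 0) with h₀ | h₀
      · obtain ⟨m, hm⟩ := exists_turningOverlap_one (n₁ := A 0 1)
          (n₂ := A 1 0) (by linarith) h₀ (by linarith) hO hs₂
          fun c => by unfold shareDiscr; ring
        exact Or.inr (Or.inr ⟨np (by linarith) (by linarith), _, _, _, m, hm⟩)
      · have h₃ := lt_of_le_of_ne h₀ hA.h00_11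
        exact Or.inl ⟨hO.trans (emp h₀), np (by linarith) (by linarith)⟩
    · have hO : overlap A = Ioo (A 1 1) (A 1 0) := by
        rw [ho]
        simp only [min_eq_left, min_eq_right, max_eq_left, max_eq_right, h.le, h'.le, h₁.le, h₂.le]
      exact Or.inr (Or.inl ⟨pp (by linarith) (by linarith), _, _,
        monotoneOverlap_of_ends (n := A 0 1) (d := A 0 0) (by linarith) hO
          (Or.inl (by linarith)) (Or.inr (by linarith))
          (Or.inr hs₃) hA.h00_01.symm⟩)
    · have hO : overlap A = Ioo (A 0 1) (A 0 0) := by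
        rw [ho]
        simp only [min_eq_left, min_eq_right, max_eq_left, max_eq_right, h.le, h'.le, h₁.le, h₂.le]
      exact Or.inr (Or.inl ⟨nn (by linarith) (by linarith), _, _,
        monotoneOverlap_of_ends (n := A 1 0) (d := A 1 1) (by linarith) hO
          (Or.inr (by linarith)) (Or.inl (by linarith))
          (Or.inl hs) hA.h10_11⟩)
    · have hO : overlap A = Ioo (A 0 1) (A 1 0) := by
        rw [ho]
        simp only [min_eq_left, min_eq_right, max_eq_left, max_eq_right, h.le, h'.le, h₁.le, h₂.le]
      rcases lt_or_ge (A 0 1) (A 1 0) with h₀ | h₀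
      · obtain ⟨m, hm⟩ := exists_turningOverlap_zero (d₁ := A 1 1)
          (d₂ := A 0 0) (by linarith) h₀ (by linarith) hO hs₂
          fun c => by unfold shareDiscr; ring
        exact Or.inr (Or.inr ⟨pn (by linarith) (by linarith), _, _, _, m, hm⟩)
      · have h₃ := lt_of_le_of_ne h₀ hA.h01_10.symm
        exact Or.inl ⟨hO.trans (emp h₀), pn (by linarith) (by linarith)⟩

end OnePlayer

/-! ### Matrices with prescribed conditional payoffs. -/

section Weights

open Set Matrix

variable {A B P : Matrix (Fin 2) (Fin 2) ℝ} {v w : ℝ}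

/-- Both actions of the row player that occur in `P` have conditional expected payoff `v`. -/
def RowEq (A : Matrix (Fin 2) (Fin 2) ℝ) (v : ℝ) (P : Matrix (Fin 2) (Fin 2) ℝ) : Prop :=
  P 0 0 * (A 0 0 - v) + P 0 1 * (A 0 1 - v) = 0 ∧ P 1 0 * (A 1 0 - v) + P 1 1 * (A 1 1 - v) = 0

/-- The expected payoff. -/
def payoff (A P : Matrix (Fin 2) (Fin 2) ℝ) : ℝ :=
  A 0 0 * P 0 0 + A 0 1 * P 0 1 + A 1 0 * P 1 0 + A 1 1 * P 1 1

theorem continuous_payoff (A : Matrix (Fin 2) (Fin 2) ℝ) : Continuous (payoff A) := by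
  unfold payoff
  fun_prop

theorem sum_sum_fin_two (P : Matrix (Fin 2) (Fin 2) ℝ) :
    ∑ i, ∑ j, P i j = P 0 0 + P 0 1 + P 1 0 + P 1 1 := by
  simp only [Fin.sum_univ_two]
  ring

theorem RowEq.payoff_eq (h : RowEq A v P) (hP : P 0 0 + P 0 1 + P 1 0 + P 1 1 = 1) :
    payoff A P = v := by
  unfold payoff
  linear_combination h.1 + h.2 + v * hP

theorem RowEq.smul (h : RowEq A v P) (c : ℝ) : RowEq A v (c • P) := by
  constructor
  · simp only [Matrix.smul_apply, smul_eq_mul]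
    linear_combination c * h.1
  · simp only [Matrix.smul_apply, smul_eq_mul]
    linear_combination c * h.2

/-- The determinant vanishes when the conditional payoffs of the two rows agree. As the total weight
is one, their common value can only be the overall expected payoff. -/
theorem det_M₁_eq_zero_iff (X : Game) (hP : P 0 0 + P 0 1 + P 1 0 + P 1 1 = 1) :
    (M₁ X P).det = 0 ↔ RowEq (X 0) (payoff (X 0) P) P := by
  rw [det_fin_two]
  simp only [M₁, of_apply, Fin.sum_univ_two, cons_val_zero, cons_val_one, RowEq, payoff]
  constructor
  · intro h
    constructor
    · linear_combination -h - (X 0 0 0 * P 0 0 + X 0 0 1 * P 0 1) * hP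
    · linear_combination h - (X 0 1 0 * P 1 0 + X 0 1 1 * P 1 1) * hP
  · rintro ⟨h₁, h₂⟩
    linear_combination (P 0 0 + P 0 1) * h₂ - (P 1 0 + P 1 1) * h₁

theorem RowEq.mem_overlap (hA : DistinctEntries A) (h : RowEq A v P) (hP : ∀ i j, 0 < P i j) :
    v ∈ overlap A := by
  have key : ∀ {p q a b : ℝ}, 0 < p → 0 < q → a ≠ b → p * (a - v) + q * (b - v) = 0 →
      0 < (v - b) * (a - v) := by
    intro p q a b hp hq hab e
    have hav : a - v ≠ 0 := by
      intro h0
      rw [h0, mul_zero, zero_add, mul_eq_zero, or_iff_right hq.ne'] at e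
      exact hab (by linarith)
    have : q * ((v - b) * (a - v)) = p * (a - v) ^ 2 := by linear_combination (v - a) * e
    have h' : 0 < q * ((v - b) * (a - v)) := by rw [this]; positivity
    exact pos_of_mul_pos_right h' hq.le
  exact ⟨key (hP 0 0) (hP 0 1) hA.h00_01 h.1, key (hP 1 0) (hP 1 1) hA.h10_11 h.2⟩

theorem RowEq.payoffShare_eq (hA : DistinctEntries A) (h : RowEq A v P) (hP : ∀ i j, 0 < P i j) :
    payoffShare A v = P 0 0 * P 1 1 / (P 0 0 * P 1 1 + P 0 1 * P 1 0) := by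
  have h00 := hP 0 0
  have h01 := hP 0 1
  have h10 := hP 1 0
  have h11 := hP 1 1
  have key : ∀ {p q a b : ℝ}, 0 < p → 0 < q → p * (a - v) + q * (b - v) = 0 →
      p * |v - a| = q * |v - b| := by
    intro p q a b hp hq e
    have e' : p * (v - a) = -(q * (v - b)) := by linear_combination -e
    have := congrArg abs e'
    rwa [abs_neg, abs_mul, abs_mul, abs_of_pos hp, abs_of_pos hq] at this
  have e₁ := key h00 h01 h.1
  have e₂ := key h10 h11 h.2
  have hden := (share_denominator_pos hA.h00_01.symm hA.h01_11 hA.h00_10.symm hA.h10_11 v).ne'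
  rw [payoffShare, share, div_eq_div_iff hden (by positivity)]
  linear_combination (-P 1 1 * |v - A 1 1|) * e₁ + P 0 1 * |v - A 0 1| * e₂

/-- The interior point of the curve is determined by the payoffs. -/
theorem eq_of_rowEq {P Q : Matrix (Fin 2) (Fin 2) ℝ} (hv : v ∈ overlap A) (hw : w ∈ overlap B)
    (hP : RowEq A v P) (hP' : RowEq B w Pᵀ) (hQ : RowEq A v Q) (hQ' : RowEq B w Qᵀ)
    (sP : P 0 0 + P 0 1 + P 1 0 + P 1 1 = 1) (sQ : Q 0 0 + Q 0 1 + Q 1 0 + Q 1 1 = 1) : P = Q := by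
  have a1 : A 0 1 - v ≠ 0 := fun h => by
    have := hv.1
    rw [show v - A 0 1 = 0 by linarith, zero_mul] at this
    exact this.false
  have a2 : A 1 1 - v ≠ 0 := fun h => by
    have := hv.2
    rw [show v - A 1 1 = 0 by linarith, zero_mul] at this
    exact this.false
  have b1 : B 0 1 - w ≠ 0 := fun h => by
    have := hw.1
    rw [show w - B 0 1 = 0 by linarith, zero_mul] at this
    exact this.false
  have p1 := hP.1
  have p2 := hP.2
  have p3 := hP'.1
  have q1 := hQ.1
  have q2 := hQ.2
  have q3 := hQ'.1
  simp only [transpose_apply] at p3 q3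
  -- Three of the four linear equations already make `P` and `Q` proportional, with ratio `P 0 0 : Q
  -- 0 0`; the normalisation then gives `P 0 0 = Q 0 0`.
  have e01 : P 0 0 * Q 0 1 = Q 0 0 * P 0 1 :=
    mul_left_cancel₀ a1 (by linear_combination P 0 0 * q1 - Q 0 0 * p1)
  have e10 : P 0 0 * Q 1 0 = Q 0 0 * P 1 0 :=
    mul_left_cancel₀ b1 (by linear_combination P 0 0 * q3 - Q 0 0 * p3)
  have e11 : P 0 0 * Q 1 1 = Q 0 0 * P 1 1 :=
    mul_left_cancel₀ a2 (by linear_combination P 0 0 * q2 - Q 0 0 * p2 - (A 1 0 - v) * e10)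
  have e00 : P 0 0 = Q 0 0 := by
    linear_combination e01 + e10 + e11 + Q 0 0 * sP - P 0 0 * sQ
  have hne : P 0 0 ≠ 0 := by
    intro h0
    rw [h0, zero_mul, zero_add, mul_eq_zero, or_iff_left a1] at p1
    rw [h0, zero_mul, zero_add, mul_eq_zero, or_iff_left b1] at p3
    rw [p3, zero_mul, zero_add, mul_eq_zero, or_iff_left a2] at p2
    linarith
  rw [← e00] at e01 e10 e11
  ext i j
  fin_cases i <;> fin_cases j
  · exact e00
  · exact (mul_left_cancel₀ hne e01).symm
  · exact (mul_left_cancel₀ hne e10).symm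
  · exact (mul_left_cancel₀ hne e11).symm

/-- Unnormalised solution of the equations `RowEq A v P` and `RowEq B w Pᵀ`. -/
def weights (A B : Matrix (Fin 2) (Fin 2) ℝ) (v w : ℝ) : Matrix (Fin 2) (Fin 2) ℝ :=
  !![|v - A 0 1| * (|v - A 1 1| * |w - B 0 1| + |v - A 1 0| * |w - B 1 1|),
      |v - A 0 0| * (|v - A 1 1| * |w - B 0 1| + |v - A 1 0| * |w - B 1 1|);
    |v - A 1 1| * (|v - A 0 1| * |w - B 0 0| + |v - A 0 0| * |w - B 1 0|),
      |v - A 1 0| * (|v - A 0 1| * |w - B 0 0| + |v - A 0 0| * |w - B 1 0|)]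

/-- The sum of the entries of `weights A B v w`. -/
def weightSum (A B : Matrix (Fin 2) (Fin 2) ℝ) (v w : ℝ) : ℝ :=
  (|v - A 0 1| + |v - A 0 0|) * (|v - A 1 1| * |w - B 0 1| + |v - A 1 0| * |w - B 1 1|) +
    (|v - A 1 1| + |v - A 1 0|) * (|v - A 0 1| * |w - B 0 0| + |v - A 0 0| * |w - B 1 0|)

/-- Positivity at all `v` and `w`, including the ends of the overlaps, is what lets the normalised
weights extend continuously to the endpoints of the arcs. -/
theorem weightSum_pos (hA : DistinctEntries A) (hB : DistinctEntries B) (v w : ℝ) :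
    0 < weightSum A B v w := by
  have ne : ∀ {x a b : ℝ}, a ≠ b → |x - a| = 0 → |x - b| ≠ 0 := fun h e e' => by
    rw [abs_eq_zero] at e e'
    exact h (by linarith)
  have pos : ∀ {x a b : ℝ}, a ≠ b → 0 < |x - a| + |x - b| := by
    intro x a b h
    by_contra! h'
    have h₁ := abs_nonneg (x - a)
    have h₂ := abs_nonneg (x - b)
    exact ne (x := x) h (by linarith) (by linarith)
  have n1 := pos (x := v) hA.h00_01.symm
  have n2 := pos (x := v) hA.h10_11.symm
  set S := |v - A 1 1| * |w - B 0 1| + |v - A 1 0| * |w - B 1 1| with hS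
  set T := |v - A 0 1| * |w - B 0 0| + |v - A 0 0| * |w - B 1 0| with hT
  have hS0 : 0 ≤ S := by positivity
  have hT0 : 0 ≤ T := by positivity
  have hW : weightSum A B v w =
    (|v - A 0 1| + |v - A 0 0|) * S + (|v - A 1 1| + |v - A 1 0|) * T := rfl
  rw [hW]
  by_contra! hle
  have z1 : S = 0 := by
    by_contra h
    have : 0 < S := lt_of_le_of_ne hS0 (Ne.symm h)
    nlinarith [mul_pos n1 this, mul_nonneg n2.le hT0]
  have z2 : T = 0 := by
    by_contra h
    have : 0 < T := lt_of_le_of_ne hT0 (Ne.symm h)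
    nlinarith [mul_pos n2 this, mul_nonneg n1.le hS0]
  have split : ∀ {p q r s : ℝ}, |p| * |q| + |r| * |s| = 0 →
      (|p| = 0 ∨ |q| = 0) ∧ (|r| = 0 ∨ |s| = 0) := by
    intro p q r s h
    have h₁ : 0 ≤ |p| * |q| := by positivity
    have h₂ : 0 ≤ |r| * |s| := by positivity
    exact ⟨mul_eq_zero.1 (by linarith), mul_eq_zero.1 (by linarith)⟩
  obtain ⟨s1, s2⟩ := split z1
  obtain ⟨s3, s4⟩ := split z2
  rcases s1 with s1 | s1
  · have s2 := s2.resolve_left (ne hA.h10_11.symm s1)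
    have s3 := s3.resolve_left (ne hA.h01_11.symm s1)
    exact ne hB.h00_11.symm s2 s3
  · have s3 := s3.resolve_right (ne hB.h00_01.symm s1)
    have s4 := s4.resolve_left (ne hA.h00_01.symm s3)
    exact ne hB.h01_10 s1 s4

theorem weights_nonneg (A B : Matrix (Fin 2) (Fin 2) ℝ) (v w : ℝ) (i j : Fin 2) :
    0 ≤ weights A B v w i j := by
  fin_cases i <;> fin_cases j <;> simp [weights] <;> positivity

theorem weights_pos (hv : v ∈ overlap A) (hw : w ∈ overlap B) (i j : Fin 2) :
    0 < weights A B v w i j := by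
  have key : ∀ {x a b : ℝ}, 0 < (x - b) * (a - x) → 0 < |x - a| ∧ 0 < |x - b| := by
    intro x a b h
    rw [abs_pos, abs_pos]
    constructor
    · intro h0
      rw [show a - x = 0 by linarith, mul_zero] at h
      exact h.false
    · intro h0
      rw [h0, zero_mul] at h
      exact h.false
  obtain ⟨a00, a01⟩ := key hv.1
  obtain ⟨a10, a11⟩ := key hv.2
  obtain ⟨b00, b01⟩ := key hw.1
  obtain ⟨b10, b11⟩ := key hw.2
  fin_cases i <;> fin_cases j <;>
    simp only [weights, Fin.zero_eta, Fin.mk_one, of_apply, cons_val_zero, cons_val_one] <;>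
    positivity

theorem abs_sub_mul_sub_add {v a b : ℝ} (h : 0 ≤ (v - b) * (a - v)) :
    |v - b| * (a - v) + |v - a| * (b - v) = 0 := by
  rcases mul_nonneg_iff.1 h with ⟨h₁, h₂⟩ | ⟨h₁, h₂⟩
  · rw [abs_of_nonneg h₁, abs_of_nonpos (by linarith)]
    ring
  · rw [abs_of_nonpos h₁, abs_of_nonneg (by linarith)]
    ring

theorem rowEq_weights (h₁ : 0 ≤ (v - A 0 1) * (A 0 0 - v)) (h₂ : 0 ≤ (v - A 1 1) * (A 1 0 - v)) :
    RowEq A v (weights A B v w) := by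
  constructor
  · simp only [weights, of_apply, cons_val_zero, cons_val_one, cons_val']
    linear_combination
      (|v - A 1 1| * |w - B 0 1| + |v - A 1 0| * |w - B 1 1|) * abs_sub_mul_sub_add h₁
  · simp only [weights, of_apply, cons_val_zero, cons_val_one, cons_val']
    linear_combination
      (|v - A 0 1| * |w - B 0 0| + |v - A 0 0| * |w - B 1 0|) * abs_sub_mul_sub_add h₂

/-- The row equations fix the proportions inside each row, leaving only the ratio of the two row
multipliers. Each column equation prescribes this ratio, and the two prescriptions agree exactly
because the shares are equal. The multipliers in `weights` are the sums of the terms of both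
prescriptions, since either one alone may degenerate to `0 : 0` at an end of an overlap. -/
theorem rowEq_transpose_weights (hA : DistinctEntries A) (hB : DistinctEntries B)
    (h₁ : 0 ≤ (w - B 0 1) * (B 0 0 - w)) (h₂ : 0 ≤ (w - B 1 1) * (B 1 0 - w))
    (hs : payoffShare A v = payoffShare B w) : RowEq B w (weights A B v w)ᵀ := by
  have hs' : |v - A 0 1| * |v - A 1 0| * (|w - B 0 0| * |w - B 1 1|) =
      |w - B 0 1| * |w - B 1 0| * (|v - A 0 0| * |v - A 1 1|) := by
    rw [payoffShare, payoffShare, share, share, div_eq_div_iff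
      (share_denominator_pos hA.h00_01.symm hA.h01_11 hA.h00_10.symm hA.h10_11 v).ne'
      (share_denominator_pos hB.h00_01.symm hB.h01_11 hB.h00_10.symm hB.h10_11 w).ne'] at hs
    linear_combination hs
  have e₁ := abs_sub_mul_sub_add h₁
  have e₂ := abs_sub_mul_sub_add h₂
  have key : ∀ {p q y y' c c' : ℝ}, y * c + y' * c' = 0 → p * y' = q * y → y + y' ≠ 0 →
      p * c + q * c' = 0 := by
    intro p q y y' c c' h h' hy
    apply mul_left_cancel₀ hy
    linear_combination (p + q) * h + (c - c') * h'
  have pos : ∀ {x a b : ℝ}, a ≠ b → |x - b| + |x - a| ≠ 0 := by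
    intro x a b h h'
    have h₁ := abs_nonneg (x - a)
    have h₂ := abs_nonneg (x - b)
    have := abs_eq_zero.1 (show |x - a| = 0 by linarith)
    have := abs_eq_zero.1 (show |x - b| = 0 by linarith)
    exact h (by linarith)
  constructor
  · refine key e₁ ?_ (pos hB.h00_01)
    simp only [weights, transpose_apply, of_apply, cons_val_zero, cons_val_one, cons_val']
    linear_combination hs'
  · refine key e₂ ?_ (pos hB.h10_11)
    simp only [weights, transpose_apply, of_apply, cons_val_zero, cons_val_one, cons_val']
    linear_combination -hs'

end Weights

/-! ### The curve of equilibria and its boundary points. -/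

section Curve

open Set Matrix

/-- The game with the roles of the players exchanged. -/
def Game.swap (X : Game) : Game := ![(X 1)ᵀ, (X 0)ᵀ]

theorem Game.swap_zero (X : Game) : X.swap 0 = (X 1)ᵀ := rfl

theorem Game.swap_swap (X : Game) : X.swap.swap = X := by
  ext k i j
  fin_cases k <;> rfl

theorem M₂_eq_M₁_swap (X : Game) (P : Matrix (Fin 2) (Fin 2) ℝ) : M₂ X P = M₁ X.swap Pᵀ := rfl

theorem M₁_eq_M₂_swap (X : Game) (P : Matrix (Fin 2) (Fin 2) ℝ) : M₁ X P = M₂ X.swap Pᵀ := rfl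

variable {X : Game} {P Q : Matrix (Fin 2) (Fin 2) ℝ} {v w : ℝ}

/-- `P` lies in the closed simplex and solves the linear equations that characterise dependency
equilibria with expected payoffs `v` and `w`. -/
structure IsSolution (X : Game) (v w : ℝ) (P : Matrix (Fin 2) (Fin 2) ℝ) : Prop where
  nonneg : ∀ i j, 0 ≤ P i j
  sum_eq : P 0 0 + P 0 1 + P 1 0 + P 1 1 = 1
  row : RowEq (X 0) v P
  col : RowEq (X 1)ᵀ w Pᵀ

theorem transpose_sum (h : P 0 0 + P 0 1 + P 1 0 + P 1 1 = 1) :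
    Pᵀ 0 0 + Pᵀ 0 1 + Pᵀ 1 0 + Pᵀ 1 1 = 1 := by
  simp only [transpose_apply]
  linarith

theorem mem_equilibriumCurve_iff : P ∈ equilibriumCurve X ↔
    (∀ i j, 0 < P i j) ∧ ∃ v w, IsSolution X v w P := by
  constructor
  · rintro ⟨⟨h₁, h₂⟩, hpos, hsum⟩
    rw [sum_sum_fin_two] at hsum
    rw [det_M₁_eq_zero_iff X hsum] at h₁
    rw [M₂_eq_M₁_swap, det_M₁_eq_zero_iff _ (transpose_sum hsum)] at h₂
    exact ⟨hpos, _, _, fun i j => (hpos i j).le, hsum, h₁, h₂⟩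
  · rintro ⟨hpos, v, w, h⟩
    refine ⟨⟨?_, ?_⟩, hpos, by rw [sum_sum_fin_two, h.sum_eq]⟩
    · rw [det_M₁_eq_zero_iff X h.sum_eq, h.row.payoff_eq h.sum_eq]
      exact h.row
    · have hs := transpose_sum h.sum_eq
      rw [M₂_eq_M₁_swap, det_M₁_eq_zero_iff _ hs, Game.swap_zero, h.col.payoff_eq hs]
      exact h.col

theorem IsSolution.payoff_left (h : IsSolution X v w P) : payoff (X 0) P = v :=
  h.row.payoff_eq h.sum_eq

theorem IsSolution.payoff_right (h : IsSolution X v w P) : payoff (X 1)ᵀ Pᵀ = w :=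
  h.col.payoff_eq (transpose_sum h.sum_eq)

theorem equilibriumCurve_swap (X : Game) :
    equilibriumCurve X = transpose '' equilibriumCurve X.swap := by
  have key : ∀ (Y : Game) (P : Matrix (Fin 2) (Fin 2) ℝ), P ∈ equilibriumCurve Y →
      Pᵀ ∈ equilibriumCurve Y.swap := by
    rintro Y P ⟨⟨h₁, h₂⟩, hpos, hsum⟩
    refine ⟨⟨?_, ?_⟩, fun i j => hpos j i, ?_⟩
    · rwa [← M₂_eq_M₁_swap]
    · rwa [← M₁_eq_M₂_swap]
    · rw [sum_sum_fin_two] at hsum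
      rw [sum_sum_fin_two]
      exact transpose_sum hsum
  ext P
  constructor
  · exact fun h => ⟨Pᵀ, key X P h, rfl⟩
  · rintro ⟨Q, hQ, rfl⟩
    have := key _ _ hQ
    rwa [Game.swap_swap] at this

theorem F_swap (X : Game) (i j : Fin 2) : (F X.swap i j)ᵀ = F X j i := by
  ext k m
  fin_cases i <;> fin_cases j <;> fin_cases k <;> fin_cases m <;>
    simp [F, Game.swap] <;> ring

theorem F_apply_self (X : Game) (i j : Fin 2) : F X i j i j = 0 := by
  fin_cases i <;> fin_cases j <;> simp [F]

theorem IsE.transpose (h : IsE P) : IsE Pᵀ := by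
  obtain ⟨i, j, rfl⟩ := h
  exact ⟨j, i, transpose_single ..⟩

theorem IsF.transpose (h : IsF X.swap P) : IsF X Pᵀ := by
  obtain ⟨i, j, c, hc, rfl⟩ := h
  exact ⟨j, i, c, hc, by rw [transpose_smul, F_swap]⟩

theorem isE_of_apply (hsum : P 0 0 + P 0 1 + P 1 0 + P 1 1 = 1) (i j : Fin 2)
    (h : ∀ k m, (k, m) ≠ (i, j) → P k m = 0) : IsE P := by
  refine ⟨i, j, ?_⟩
  ext k m
  have h00 := h 0 0
  have h01 := h 0 1
  have h10 := h 1 0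
  have h11 := h 1 1
  fin_cases i <;> fin_cases j <;> fin_cases k <;> fin_cases m <;> simp_all

theorem right_eq_zero_of_rowEq {p q a b v : ℝ} (h : p * (a - v) + q * (b - v) = 0)
    (h₁ : p * (a - v) = 0) (h₂ : b ≠ v) : q = 0 := by
  rw [h₁, zero_add, mul_eq_zero] at h
  exact h.resolve_right (sub_ne_zero.2 h₂)

theorem left_eq_zero_of_rowEq {p q a b v : ℝ} (h : p * (a - v) + q * (b - v) = 0)
    (h₁ : q * (b - v) = 0) (h₂ : a ≠ v) : p = 0 := by
  rw [h₁, add_zero, mul_eq_zero] at h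
  exact h.resolve_right (sub_ne_zero.2 h₂)

/-- A solution whose payoffs are the entries of the same cell is a coordinate point. -/
theorem IsSolution.isE (hA : DistinctEntries (X 0)) (hB : DistinctEntries (X 1)ᵀ)
    (h : IsSolution X v w P)
    (hvw : (v = X 0 0 0 ∧ w = X 1 0 0) ∨ (v = X 0 0 1 ∧ w = X 1 0 1) ∨
      (v = X 0 1 0 ∧ w = X 1 1 0) ∨ (v = X 0 1 1 ∧ w = X 1 1 1)) : IsE P := by
  obtain ⟨-, hs, ⟨r₁, r₂⟩, c₁, c₂⟩ := h
  obtain ⟨a1, -, a3, a4, -, a6⟩ := hA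
  obtain ⟨b1, -, b3, b4, -, b6⟩ := hB
  simp only [transpose_apply] at b1 b3 b4 b6 c₁ c₂
  rcases hvw with ⟨rfl, rfl⟩ | ⟨rfl, rfl⟩ | ⟨rfl, rfl⟩ | ⟨rfl, rfl⟩
  · have h01 := right_eq_zero_of_rowEq r₁ (by simp) a1.symm
    have h10 := right_eq_zero_of_rowEq c₁ (by simp) b1.symm
    have h11 := right_eq_zero_of_rowEq r₂ (by simp [h10]) a3.symm
    refine isE_of_apply hs 0 0 fun k m hkm => ?_
    fin_cases k <;> fin_cases m <;> simp_all
  · have h00 := left_eq_zero_of_rowEq r₁ (by simp) a1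
    have h11 := right_eq_zero_of_rowEq c₂ (by simp) b6.symm
    have h10 := left_eq_zero_of_rowEq r₂ (by simp [h11]) a4.symm
    refine isE_of_apply hs 0 1 fun k m hkm => ?_
    fin_cases k <;> fin_cases m <;> simp_all
  · have h11 := right_eq_zero_of_rowEq r₂ (by simp) a6.symm
    have h00 := left_eq_zero_of_rowEq c₁ (by simp) b1
    have h01 := right_eq_zero_of_rowEq r₁ (by simp [h00]) a4
    refine isE_of_apply hs 1 0 fun k m hkm => ?_
    fin_cases k <;> fin_cases m <;> simp_all
  · have h10 := left_eq_zero_of_rowEq r₂ (by simp) a6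
    have h01 := left_eq_zero_of_rowEq c₂ (by simp) b6
    have h00 := left_eq_zero_of_rowEq r₁ (by simp [h01]) a3
    refine isE_of_apply hs 1 1 fun k m hkm => ?_
    fin_cases k <;> fin_cases m <;> simp_all

/-- A solution whose payoffs are the entries of two suitable different cells is one of the points
`F_{ij}`. -/
theorem IsSolution.isF (hA : DistinctEntries (X 0)) (hB : DistinctEntries (X 1)ᵀ)
    (h : IsSolution X v w P)
    (hvw : (v = X 0 0 1 ∧ w = X 1 1 0) ∨ (v = X 0 0 0 ∧ w = X 1 1 1) ∨
      (v = X 0 1 1 ∧ w = X 1 0 0) ∨ (v = X 0 1 0 ∧ w = X 1 0 1)) : IsF X P := by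
  obtain ⟨-, hs, ⟨r₁, r₂⟩, c₁, c₂⟩ := h
  obtain ⟨a1, -, a3, a4, a5, a6⟩ := hA
  obtain ⟨b1, -, b3, b4, b5, b6⟩ := hB
  simp only [transpose_apply] at b1 b3 b4 b5 b6 c₁ c₂
  rcases hvw with ⟨rfl, rfl⟩ | ⟨rfl, rfl⟩ | ⟨rfl, rfl⟩ | ⟨rfl, rfl⟩
  · have h00 := left_eq_zero_of_rowEq r₁ (by simp) a1
    have hk : (X 0 0 1 - X 0 1 0) * (X 1 0 1 - X 1 1 0) ≠ 0 :=
      mul_ne_zero (sub_ne_zero.2 a4) (sub_ne_zero.2 b4.symm)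
    -- The scalar in `IsF` has to be nonzero; if this entry vanished, the linear equations would
    -- make all of `P` vanish.
    have hP : P 1 1 ≠ 0 := by
      intro h11
      have h01 := left_eq_zero_of_rowEq c₂ (by simp [h11]) b4.symm
      have h10 := left_eq_zero_of_rowEq r₂ (by simp [h11]) a4.symm
      linarith
    refine ⟨0, 0, P 1 1 / ((X 0 0 1 - X 0 1 0) * (X 1 0 1 - X 1 1 0)), div_ne_zero hP hk, ?_⟩
    ext k m
    fin_cases k <;> fin_cases m <;>
      simp only [F, Fin.zero_eta, Fin.mk_one, Matrix.smul_apply, smul_eq_mul, of_apply,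
        cons_val_zero, cons_val_one, cons_val', div_mul_eq_mul_div, eq_div_iff hk]
    · rw [h00]; ring
    · linear_combination (X 0 0 1 - X 0 1 0) * c₂
    · linear_combination -(X 1 0 1 - X 1 1 0) * r₂
  · have h01 := right_eq_zero_of_rowEq r₁ (by simp) a1.symm
    have hk : (X 0 0 0 - X 0 1 1) * (X 1 1 0 - X 1 1 1) ≠ 0 :=
      mul_ne_zero (sub_ne_zero.2 a3) (sub_ne_zero.2 b5)
    have hP : P 0 0 ≠ 0 := by
      intro h00
      have h10 := right_eq_zero_of_rowEq c₁ (by simp [h00]) b5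
      have h11 := right_eq_zero_of_rowEq r₂ (by simp [h10]) a3.symm
      linarith
    refine ⟨0, 1, P 0 0 / ((X 0 0 0 - X 0 1 1) * (X 1 1 0 - X 1 1 1)), div_ne_zero hP hk, ?_⟩
    ext k m
    fin_cases k <;> fin_cases m <;>
      simp only [F, Fin.zero_eta, Fin.mk_one, Matrix.smul_apply, smul_eq_mul, of_apply,
        cons_val_zero, cons_val_one, cons_val', div_mul_eq_mul_div, eq_div_iff hk]
    · rw [h01]; ring
    · linear_combination (X 0 0 0 - X 0 1 1) * c₁
    · linear_combination -(X 1 1 0 - X 1 1 1) * r₂ - (X 0 0 0 - X 0 1 0) * c₁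
  · have h10 := left_eq_zero_of_rowEq r₂ (by simp) a6
    have hk : (X 0 0 1 - X 0 1 1) * (X 1 0 0 - X 1 1 1) ≠ 0 :=
      mul_ne_zero (sub_ne_zero.2 a5) (sub_ne_zero.2 b3)
    have hP : P 0 0 ≠ 0 := by
      intro h00
      have h01 := right_eq_zero_of_rowEq r₁ (by simp [h00]) a5
      have h11 := right_eq_zero_of_rowEq c₂ (by simp [h01]) b3.symm
      linarith
    refine ⟨1, 0, P 0 0 / ((X 0 0 1 - X 0 1 1) * (X 1 0 0 - X 1 1 1)), div_ne_zero hP hk, ?_⟩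
    ext k m
    fin_cases k <;> fin_cases m <;>
      simp only [F, Fin.zero_eta, Fin.mk_one, Matrix.smul_apply, smul_eq_mul, of_apply,
        cons_val_zero, cons_val_one, cons_val', div_mul_eq_mul_div, eq_div_iff hk]
    · linear_combination (X 1 0 0 - X 1 1 1) * r₁
    · rw [h10]; ring
    · linear_combination -(X 0 0 1 - X 0 1 1) * c₂ - (X 1 0 0 - X 1 0 1) * r₁
  · have h11 := right_eq_zero_of_rowEq r₂ (by simp) a6.symm
    have hk : (X 0 0 1 - X 0 1 0) * (X 1 0 1 - X 1 1 0) ≠ 0 :=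
      mul_ne_zero (sub_ne_zero.2 a4) (sub_ne_zero.2 b4.symm)
    have hP : P 0 0 ≠ 0 := by
      intro h00
      have h01 := right_eq_zero_of_rowEq r₁ (by simp [h00]) a4
      have h10 := right_eq_zero_of_rowEq c₁ (by simp [h00]) b4
      linarith
    refine ⟨1, 1, P 0 0 / ((X 0 0 1 - X 0 1 0) * (X 1 0 1 - X 1 1 0)), div_ne_zero hP hk, ?_⟩
    ext k m
    fin_cases k <;> fin_cases m <;>
      simp only [F, Fin.zero_eta, Fin.mk_one, Matrix.smul_apply, smul_eq_mul, of_apply,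
        cons_val_zero, cons_val_one, cons_val', div_mul_eq_mul_div, eq_div_iff hk]
    · linear_combination (X 1 0 1 - X 1 1 0) * r₁
    · linear_combination -(X 0 0 1 - X 0 1 0) * c₁
    · rw [h11]; ring

/-- Share `0` puts both payoffs at off-diagonal entries, share `1` at diagonal ones. Of the four
combinations in each case, two name the same cell for both players and give an `E` point; the other
two give an `F` point. -/
theorem IsSolution.isE_or_isF (hA : DistinctEntries (X 0)) (hB : DistinctEntries (X 1)ᵀ)
    (h : IsSolution X v w P) (hs : payoffShare (X 0) v = payoffShare (X 1)ᵀ w)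
    (hw : payoffShare (X 1)ᵀ w = 0 ∨ payoffShare (X 1)ᵀ w = 1) : IsE P ∨ IsF X P := by
  rcases hw with hw | hw
  · rw [hw, hA.payoffShare_eq_zero] at hs
    rw [hB.payoffShare_eq_zero] at hw
    simp only [transpose_apply] at hw
    rcases hs with hs | hs <;> rcases hw with hw | hw
    · exact Or.inr (h.isF hA hB (by tauto))
    · exact Or.inl (h.isE hA hB (by tauto))
    · exact Or.inl (h.isE hA hB (by tauto))
    · exact Or.inr (h.isF hA hB (by tauto))
  · rw [hw, hA.payoffShare_eq_one] at hs
    rw [hB.payoffShare_eq_one] at hw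
    simp only [transpose_apply] at hw
    rcases hs with hs | hs <;> rcases hw with hw | hw
    · exact Or.inl (h.isE hA hB (by tauto))
    · exact Or.inr (h.isF hA hB (by tauto))
    · exact Or.inr (h.isF hA hB (by tauto))
    · exact Or.inl (h.isE hA hB (by tauto))

/-- The payoff `w` can be either of two entries of the second player, and exactly one of them sits
in the cell of `v`. Two solutions with the same `v` and different `w` use both entries. -/
theorem IsSolution.isE_and_isF (hA : DistinctEntries (X 0)) (hB : DistinctEntries (X 1)ᵀ)
    {w' : ℝ} (hP : IsSolution X v w P) (hQ : IsSolution X v w' Q) (hne : w ≠ w')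
    (hs : payoffShare (X 0) v = payoffShare (X 1)ᵀ w)
    (hs' : payoffShare (X 0) v = payoffShare (X 1)ᵀ w')
    (hw : payoffShare (X 1)ᵀ w = 0 ∨ payoffShare (X 1)ᵀ w = 1) :
    IsE P ∧ IsF X Q ∨ IsF X P ∧ IsE Q := by
  have hw' := hs.symm.trans hs'
  rcases hw with hw | hw
  · rw [hw] at hw' hs
    rw [eq_comm, hB.payoffShare_eq_zero] at hw'
    rw [hB.payoffShare_eq_zero] at hw
    rw [hA.payoffShare_eq_zero] at hs
    simp only [transpose_apply] at hw hw'
    rcases hw with hw | hw <;> rcases hw' with hw' | hw'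
    · exact absurd (hw.trans hw'.symm) hne
    · rcases hs with hs | hs
      · exact Or.inr ⟨hP.isF hA hB (by tauto), hQ.isE hA hB (by tauto)⟩
      · exact Or.inl ⟨hP.isE hA hB (by tauto), hQ.isF hA hB (by tauto)⟩
    · rcases hs with hs | hs
      · exact Or.inl ⟨hP.isE hA hB (by tauto), hQ.isF hA hB (by tauto)⟩
      · exact Or.inr ⟨hP.isF hA hB (by tauto), hQ.isE hA hB (by tauto)⟩
    · exact absurd (hw.trans hw'.symm) hne
  · rw [hw] at hw' hs
    rw [eq_comm, hB.payoffShare_eq_one] at hw'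
    rw [hB.payoffShare_eq_one] at hw
    rw [hA.payoffShare_eq_one] at hs
    simp only [transpose_apply] at hw hw'
    rcases hw with hw | hw <;> rcases hw' with hw' | hw'
    · exact absurd (hw.trans hw'.symm) hne
    · rcases hs with hs | hs
      · exact Or.inl ⟨hP.isE hA hB (by tauto), hQ.isF hA hB (by tauto)⟩
      · exact Or.inr ⟨hP.isF hA hB (by tauto), hQ.isE hA hB (by tauto)⟩
    · rcases hs with hs | hs
      · exact Or.inr ⟨hP.isF hA hB (by tauto), hQ.isE hA hB (by tauto)⟩
      · exact Or.inl ⟨hP.isE hA hB (by tauto), hQ.isF hA hB (by tauto)⟩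
    · exact absurd (hw.trans hw'.symm) hne

theorem IsSolution.mem_simplexBoundary (h : IsSolution X v w P) (hEF : IsE P ∨ IsF X P) :
    P ∈ simplexBoundary := by
  refine ⟨h.nonneg, by rw [sum_sum_fin_two, h.sum_eq], ?_⟩
  rcases hEF with ⟨i, j, rfl⟩ | ⟨i, j, c, -, rfl⟩
  -- In `Fin 2`, `i + 1` is the other row.
  · exact ⟨i + 1, j, by fin_cases i <;> fin_cases j <;> simp⟩
  · exact ⟨i, j, by rw [Matrix.smul_apply, F_apply_self, smul_zero]⟩

/-- The solution with expected payoffs `v` and `w`. -/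
noncomputable def solution (X : Game) (v w : ℝ) : Matrix (Fin 2) (Fin 2) ℝ :=
  (weightSum (X 0) (X 1)ᵀ v w)⁻¹ • weights (X 0) (X 1)ᵀ v w

theorem isSolution_solution (hA : DistinctEntries (X 0)) (hB : DistinctEntries (X 1)ᵀ)
    (hv : v ∈ closure (overlap (X 0))) (hw : w ∈ closure (overlap (X 1)ᵀ))
    (hs : payoffShare (X 0) v = payoffShare (X 1)ᵀ w) : IsSolution X v w (solution X v w) := by
  have hpos := weightSum_pos hA hB v w
  have cl : ∀ (A : Matrix (Fin 2) (Fin 2) ℝ) (v : ℝ), v ∈ closure (overlap A) →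
      0 ≤ (v - A 0 1) * (A 0 0 - v) ∧ 0 ≤ (v - A 1 1) * (A 1 0 - v) := by
    intro A v hv
    have hc : IsClosed
        ({v | 0 ≤ (v - A 0 1) * (A 0 0 - v)} ∩ {v | 0 ≤ (v - A 1 1) * (A 1 0 - v)}) :=
      (isClosed_le continuous_const (by fun_prop)).inter
        (isClosed_le continuous_const (by fun_prop))
    have hsub : overlap A ⊆
        {v | 0 ≤ (v - A 0 1) * (A 0 0 - v)} ∩ {v | 0 ≤ (v - A 1 1) * (A 1 0 - v)} :=
      fun x hx => ⟨hx.1.le, hx.2.le⟩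
    exact closure_minimal hsub hc hv
  obtain ⟨v₁, v₂⟩ := cl _ _ hv
  obtain ⟨w₁, w₂⟩ := cl _ _ hw
  refine ⟨fun i j => ?_, ?_, (rowEq_weights v₁ v₂).smul _, ?_⟩
  · exact mul_nonneg (inv_nonneg.2 hpos.le) (weights_nonneg _ _ _ _ _ _)
  · have : weights (X 0) (X 1)ᵀ v w 0 0 + weights (X 0) (X 1)ᵀ v w 0 1 +
        weights (X 0) (X 1)ᵀ v w 1 0 + weights (X 0) (X 1)ᵀ v w 1 1 =
        weightSum (X 0) (X 1)ᵀ v w := by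
      simp only [weights, weightSum, of_apply, cons_val_zero, cons_val_one, cons_val']
      ring
    simp only [solution, Matrix.smul_apply, smul_eq_mul]
    rw [← mul_add, ← mul_add, ← mul_add, this, inv_mul_cancel₀ hpos.ne']
  · rw [solution, transpose_smul]
    exact (rowEq_transpose_weights hA hB w₁ w₂ hs).smul _

theorem solution_pos (hA : DistinctEntries (X 0)) (hB : DistinctEntries (X 1)ᵀ)
    (hv : v ∈ overlap (X 0)) (hw : w ∈ overlap (X 1)ᵀ) (i j : Fin 2) : 0 < solution X v w i j := by
  rw [solution, Matrix.smul_apply, smul_eq_mul]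
  exact mul_pos (inv_pos.2 (weightSum_pos hA hB _ _)) (weights_pos hv hw i j)

theorem DistinctEntries.payoffShare_ne {A : Matrix (Fin 2) (Fin 2) ℝ} (hA : DistinctEntries A)
    (hv : v ∈ overlap A) : payoffShare A v ≠ 0 ∧ payoffShare A v ≠ 1 := by
  constructor
  · rw [Ne, hA.payoffShare_eq_zero]
    rintro (rfl | rfl)
    · exact absurd hv.1 (by simp)
    · exact absurd hv.2 (by simp)
  · rw [Ne, hA.payoffShare_eq_one]
    rintro (rfl | rfl)
    · exact absurd hv.1 (by simp)
    · exact absurd hv.2 (by simp)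

theorem continuous_solution (hA : DistinctEntries (X 0)) (hB : DistinctEntries (X 1)ᵀ) :
    Continuous fun x : ℝ × ℝ => solution X x.1 x.2 := by
  unfold solution
  refine Continuous.smul (Continuous.inv₀ ?_ fun x => (weightSum_pos hA hB _ _).ne') ?_
  · unfold weightSum
    fun_prop
  · refine continuous_matrix fun i j => ?_
    fin_cases i <;> fin_cases j <;>
      simp only [weights, Fin.zero_eta, Fin.mk_one, of_apply, cons_val_zero, cons_val_one,
        cons_val'] <;> fun_prop

theorem continuousOn_diagonal {α : Type*} [TopologicalSpace α] {f : ℝ → ℝ → α}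
    (hf : Continuous fun x : ℝ × ℝ => f x.1 x.2) {h : ℝ → ℝ} {s : Set ℝ} (hh : ContinuousOn h s) :
    ContinuousOn (fun w => f (h w) w) s :=
  hf.comp_continuousOn (hh.prodMk continuousOn_id)

/-- The dependency equilibria at which the payoff of the first player is the function `h` of the
payoff of the second player. -/
def branch (X : Game) (h : ℝ → ℝ) : Set (Matrix (Fin 2) (Fin 2) ℝ) :=
  {P | P ∈ equilibriumCurve X ∧ payoff (X 0) P = h (payoff (X 1)ᵀ Pᵀ)}

/-- The payoffs determine the equilibrium, and on the branch `w` determines `v`, so `w` parametrizes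
the branch. -/
theorem branch_eq_image (hA : DistinctEntries (X 0)) (hB : DistinctEntries (X 1)ᵀ) {h : ℝ → ℝ}
    (hmem : ∀ w ∈ overlap (X 1)ᵀ, h w ∈ overlap (X 0))
    (hs : ∀ w ∈ overlap (X 1)ᵀ, payoffShare (X 0) (h w) = payoffShare (X 1)ᵀ w) :
    branch X h = (fun w => solution X (h w) w) '' overlap (X 1)ᵀ := by
  have hsol : ∀ w ∈ overlap (X 1)ᵀ, IsSolution X (h w) w (solution X (h w) w) := fun w hw =>
    isSolution_solution hA hB (subset_closure (hmem w hw)) (subset_closure hw) (hs w hw)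
  apply Subset.antisymm
  · intro P hP
    obtain ⟨hP, he⟩ := hP
    obtain ⟨hpos, v, w, hS⟩ := mem_equilibriumCurve_iff.1 hP
    rw [hS.payoff_left, hS.payoff_right] at he
    subst he
    have hw : w ∈ overlap (X 1)ᵀ := hS.col.mem_overlap hB fun i j => hpos j i
    have hv := hS.row.mem_overlap hA hpos
    have hS' := hsol w hw
    exact ⟨w, hw,
      eq_of_rowEq hv hw hS'.row hS'.col hS.row hS.col hS'.sum_eq hS.sum_eq⟩
  · apply image_subset_iff.2
    intro w hw
    have hS := hsol w hw
    refine And.intro (mem_equilibriumCurve_iff.2 ⟨?_, _, _, hS⟩) ?_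
    · exact solution_pos hA hB (hmem w hw) hw
    · exact hS.payoff_left.trans (congrArg h hS.payoff_right.symm)

/-- Along a branch `v = h w` of the equation `payoffShare (X 0) v = payoffShare (X 1)ᵀ w`, the
dependency equilibria form an arc. -/
theorem exists_isArcBetween_branch (hA : DistinctEntries (X 0)) (hB : DistinctEntries (X 1)ᵀ)
    {l u l' u' : ℝ} (hI : overlap (X 0) = Ioo l u) (hlu : l < u)
    (hl : payoffShare (X 0) l = 0 ∨ payoffShare (X 0) l = 1)
    (hu : payoffShare (X 0) u = 0 ∨ payoffShare (X 0) u = 1)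
    (hJ : overlap (X 1)ᵀ = Ioo l' u') (hlu' : l' < u') {h : ℝ → ℝ}
    (hc : ContinuousOn h (Icc l' u')) (hm : MapsTo h (Icc l' u') (Icc l u))
    (hs : ∀ w ∈ Icc l' u', payoffShare (X 0) (h w) = payoffShare (X 1)ᵀ w) :
    ∃ P Q, IsSolution X (h l') l' P ∧ IsSolution X (h u') u' Q ∧
      IsArcBetween (branch X h) P Q := by
  have hsol : ∀ w ∈ Icc l' u', IsSolution X (h w) w (solution X (h w) w) := by
    intro w hw
    refine isSolution_solution hA hB ?_ ?_ (hs w hw)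
    · rw [hI, closure_Ioo hlu.ne]
      exact hm hw
    · rwa [hJ, closure_Ioo hlu'.ne]
  refine ⟨solution X (h l') l', solution X (h u') u', hsol _ (left_mem_Icc.2 hlu'.le),
    hsol _ (right_mem_Icc.2 hlu'.le), ?_⟩
  have hcont : ContinuousOn (fun w => solution X (h w) w) (Icc l' u') :=
    continuousOn_diagonal (continuous_solution hA hB) hc
  -- The parameter `w` is recovered as the expected payoff of the second player.
  have hinj : InjOn (fun w => solution X (h w) w) (Icc l' u') := by
    intro w hw w' hw' e
    have e' : solution X (h w) w = solution X (h w') w' := e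
    rw [← (hsol w hw).payoff_right, ← (hsol w' hw').payoff_right, e']
  have hsub : overlap (X 1)ᵀ ⊆ Icc l' u' := hJ ▸ Ioo_subset_Icc_self
  rw [branch_eq_image hA hB (fun w hw => ?_) (fun w hw => hs w (hsub hw)), hJ]
  · exact isArcBetween_of_Icc hlu' hcont hinj
  -- For `w` inside its overlap the share is neither `0` nor `1`, so `h w` cannot be an end of the
  -- overlap of the first player.
  · obtain ⟨h0, h1⟩ := hB.payoffShare_ne hw
    have hw' := hsub hw
    rw [← hs w hw'] at h0 h1
    rw [hI]
    refine ⟨lt_of_le_of_ne (hm hw').1 fun e => ?_, lt_of_le_of_ne (hm hw').2 fun e => ?_⟩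
    · rw [← e] at h0 h1
      exact hl.elim h0 h1
    · rw [e] at h0 h1
      exact hu.elim h0 h1

/-- Both shares equal `p₁₁ p₂₂ / (p₁₁ p₂₂ + p₁₂ p₂₁)`, which does not change under transposition.
This equation couples the two players. -/
theorem payoffShare_eq_of_mem_equilibriumCurve (hA : DistinctEntries (X 0))
    (hB : DistinctEntries (X 1)ᵀ) (hP : P ∈ equilibriumCurve X) :
    payoff (X 0) P ∈ overlap (X 0) ∧ payoff (X 1)ᵀ Pᵀ ∈ overlap (X 1)ᵀ ∧
      payoffShare (X 0) (payoff (X 0) P) = payoffShare (X 1)ᵀ (payoff (X 1)ᵀ Pᵀ) := by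
  obtain ⟨hpos, v, w, hS⟩ := mem_equilibriumCurve_iff.1 hP
  have hpos' : ∀ i j, 0 < Pᵀ i j := fun i j => hpos j i
  rw [hS.payoff_left, hS.payoff_right]
  refine ⟨hS.row.mem_overlap hA hpos, hS.col.mem_overlap hB hpos', ?_⟩
  rw [hS.row.payoffShare_eq hA hpos, hS.col.payoffShare_eq hB hpos']
  simp only [transpose_apply, mul_comm (P 1 0)]

end Curve

/-! ### Decomposition of the curve into arcs. -/

section Decomposition

open Set Matrix

variable {X : Game}

/-- An `EF` arc whose endpoints are boundary points of the simplex. -/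
def IsEFBoundaryArc (X : Game) (C : Set (Matrix (Fin 2) (Fin 2) ℝ)) : Prop :=
  ∃ P Q, (IsE P ∧ P ∈ simplexBoundary) ∧ (IsF X Q ∧ Q ∈ simplexBoundary) ∧ IsArcBetween C P Q

/-- The curve of dependency equilibria consists of two separated `EF` arcs. -/
def HasTwoEFArcs (X : Game) : Prop :=
  ∃ C₁ C₂, equilibriumCurve X = C₁ ∪ C₂ ∧ IsEFBoundaryArc X C₁ ∧ IsEFBoundaryArc X C₂ ∧
    ∃ ξ : Matrix (Fin 2) (Fin 2) ℝ → ℝ, Continuous ξ ∧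
      ∃ c, (∀ P ∈ C₁, ξ P < c) ∧ ∀ P ∈ C₂, c < ξ P

theorem transpose_mem_simplexBoundary {P : Matrix (Fin 2) (Fin 2) ℝ} (h : P ∈ simplexBoundary) :
    Pᵀ ∈ simplexBoundary := by
  obtain ⟨h₁, h₂, i, j, h₃⟩ := h
  rw [sum_sum_fin_two] at h₂
  exact ⟨fun i j => h₁ j i, by rw [sum_sum_fin_two]; exact transpose_sum h₂, j, i, h₃⟩

theorem IsEFBoundaryArc.transpose {C : Set (Matrix (Fin 2) (Fin 2) ℝ)}
    (h : IsEFBoundaryArc X.swap C) : IsEFBoundaryArc X (Matrix.transpose '' C) := by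
  obtain ⟨P, Q, ⟨hP, hP'⟩, ⟨hQ, hQ'⟩, hC⟩ := h
  exact ⟨Pᵀ, Qᵀ, ⟨hP.transpose, transpose_mem_simplexBoundary hP'⟩,
    ⟨hQ.transpose, transpose_mem_simplexBoundary hQ'⟩,
    hC.image (continuous_id.matrix_transpose) transpose_injective⟩

theorem HasTwoEFArcs.of_swap (h : HasTwoEFArcs X.swap) : HasTwoEFArcs X := by
  obtain ⟨C₁, C₂, hC, h₁, h₂, ξ, hξ, c, hc₁, hc₂⟩ := h
  refine ⟨_, _, by rw [equilibriumCurve_swap, hC, image_union], h₁.transpose, h₂.transpose,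
    fun P => ξ Pᵀ, hξ.comp continuous_id.matrix_transpose, c, ?_, ?_⟩
  · rintro _ ⟨P, hP, rfl⟩
    exact hc₁ P hP
  · rintro _ ⟨P, hP, rfl⟩
    exact hc₂ P hP

theorem MonotoneOverlap.left_mem {A : Matrix (Fin 2) (Fin 2) ℝ} {l u : ℝ}
    (h : MonotoneOverlap A l u) : payoffShare A l = 0 ∨ payoffShare A l = 1 :=
  h.ends.imp And.left And.left

theorem MonotoneOverlap.right_mem {A : Matrix (Fin 2) (Fin 2) ℝ} {l u : ℝ}
    (h : MonotoneOverlap A l u) : payoffShare A u = 0 ∨ payoffShare A u = 1 :=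
  h.ends.symm.imp And.right And.right

theorem TurningOverlap.lt {A : Matrix (Fin 2) (Fin 2) ℝ} {e l u m : ℝ}
    (h : TurningOverlap A e l u m) : l < u :=
  h.left_lt.trans h.lt_right

theorem TurningOverlap.value_mem {A : Matrix (Fin 2) (Fin 2) ℝ} {e l u m : ℝ}
    (h : TurningOverlap A e l u m) : e = 0 ∨ e = 1 :=
  h.bounds.imp And.left And.left

/-- A monotone share takes every value in `[0, 1]` exactly once on the closed overlap, so `v` is a
continuous function of `w` and a single branch is the whole curve. -/
theorem MonotoneOverlap.exists_branch (hA : DistinctEntries (X 0)) (hB : DistinctEntries (X 1)ᵀ)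
    {l u l' u' : ℝ} (h : MonotoneOverlap (X 0) l u) (hJ : overlap (X 1)ᵀ = Ioo l' u')
    (hlu' : l' < u') :
    ∃ g : ℝ → ℝ, ContinuousOn g (Icc l' u') ∧ MapsTo g (Icc l' u') (Icc l u) ∧
      (∀ w ∈ Icc l' u', payoffShare (X 0) (g w) = payoffShare (X 1)ᵀ w) ∧
      branch X g = equilibriumCurve X := by
  have hrange : ∀ w ∈ Icc l' u', payoffShare (X 1)ᵀ w ∈ payoffShare (X 0) '' Icc l u := by
    intro w _
    have h01 : payoffShare (X 1)ᵀ w ∈ Icc 0 1 := ⟨share_nonneg _ _ _ _ _, share_le_one _ _ _ _ _⟩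
    have hivt := intermediate_value_uIcc (a := l) (b := u) hA.continuous_payoffShare.continuousOn
    rw [uIcc_of_le h.lt.le] at hivt
    apply hivt
    rcases h.ends with ⟨e₁, e₂⟩ | ⟨e₁, e₂⟩
    · rwa [e₁, e₂, uIcc_of_le zero_le_one]
    · rwa [e₁, e₂, uIcc_of_ge zero_le_one]
  obtain ⟨g, hg, hm, hs⟩ := exists_continuousOn_lift isCompact_Icc
    hA.continuous_payoffShare.continuousOn h.injOn (nonempty_Icc.2 hlu'.le)
    hB.continuous_payoffShare.continuousOn hrange
  refine ⟨g, hg, hm, hs, Subset.antisymm (fun P hP => hP.1) fun P hP => ⟨hP, ?_⟩⟩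
  obtain ⟨hv, hw, he⟩ := payoffShare_eq_of_mem_equilibriumCurve hA hB hP
  rw [h.overlap_eq] at hv
  rw [hJ] at hw
  have hw' := Ioo_subset_Icc_self hw
  exact h.injOn (Ioo_subset_Icc_self hv) (hm hw') (he.trans (hs _ hw').symm)

theorem exists_isArcBetween_of_monotone (hA : DistinctEntries (X 0))
    (hB : DistinctEntries (X 1)ᵀ) {l u l' u' : ℝ} (h : MonotoneOverlap (X 0) l u)
    (h' : MonotoneOverlap (X 1)ᵀ l' u') :
    ∃ P Q, ((IsE P ∨ IsF X P) ∧ P ∈ simplexBoundary) ∧ ((IsE Q ∨ IsF X Q) ∧ Q ∈ simplexBoundary) ∧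
      IsArcBetween (equilibriumCurve X) P Q := by
  obtain ⟨g, hg, hm, hs, hbr⟩ := h.exists_branch hA hB h'.overlap_eq h'.lt
  obtain ⟨P, Q, hP, hQ, hC⟩ := exists_isArcBetween_branch hA hB h.overlap_eq h.lt h.left_mem
    h.right_mem h'.overlap_eq h'.lt hg hm hs
  have hP' := hP.isE_or_isF hA hB (hs _ (left_mem_Icc.2 h'.lt.le)) h'.left_mem
  have hQ' := hQ.isE_or_isF hA hB (hs _ (right_mem_Icc.2 h'.lt.le)) h'.right_mem
  exact ⟨P, Q, ⟨hP', hP.mem_simplexBoundary hP'⟩, ⟨hQ', hQ.mem_simplexBoundary hQ'⟩, hbr ▸ hC⟩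

/-- The two endpoints share the same `v` but have the different payoffs `l'` and `u'` for the second
player, so `IsSolution.isE_and_isF` applies. -/
theorem isEFBoundaryArc_branch (hA : DistinctEntries (X 0)) (hB : DistinctEntries (X 1)ᵀ)
    {e l u l' u' m' : ℝ} (hI : overlap (X 0) = Ioo l u) (hlu : l < u)
    (hl : payoffShare (X 0) l = 0 ∨ payoffShare (X 0) l = 1)
    (hu : payoffShare (X 0) u = 0 ∨ payoffShare (X 0) u = 1)
    (h' : TurningOverlap (X 1)ᵀ e l' u' m') {g : ℝ → ℝ}
    (hc : ContinuousOn g (Icc l' u')) (hm : MapsTo g (Icc l' u') (Icc l u))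
    (hs : ∀ w ∈ Icc l' u', payoffShare (X 0) (g w) = payoffShare (X 1)ᵀ w)
    (hends : g l' = g u') : IsEFBoundaryArc X (branch X g) := by
  obtain ⟨P, Q, hP, hQ, hC⟩ := exists_isArcBetween_branch hA hB hI hlu hl hu h'.overlap_eq h'.lt
    hc hm hs
  have hs₁ := hs _ (left_mem_Icc.2 h'.lt.le)
  have hs₂ := hs _ (right_mem_Icc.2 h'.lt.le)
  rw [← hends] at hQ hs₂
  rcases hP.isE_and_isF hA hB hQ h'.lt.ne hs₁ hs₂ (h'.apply_left ▸ h'.value_mem) with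
    ⟨h₁, h₂⟩ | ⟨h₁, h₂⟩
  · exact ⟨P, Q, ⟨h₁, hP.mem_simplexBoundary (Or.inl h₁)⟩,
      ⟨h₂, hQ.mem_simplexBoundary (Or.inr h₂)⟩, hC⟩
  · exact ⟨Q, P, ⟨h₂, hQ.mem_simplexBoundary (Or.inl h₂)⟩,
      ⟨h₁, hP.mem_simplexBoundary (Or.inr h₁)⟩, hC.symm⟩

theorem isEFBoundaryArc_of_monotone_turning (hA : DistinctEntries (X 0))
    (hB : DistinctEntries (X 1)ᵀ) {e l u l' u' m' : ℝ} (h : MonotoneOverlap (X 0) l u)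
    (h' : TurningOverlap (X 1)ᵀ e l' u' m') : IsEFBoundaryArc X (equilibriumCurve X) := by
  obtain ⟨g, hg, hm, hs, hbr⟩ := h.exists_branch hA hB h'.overlap_eq h'.lt
  have hl := left_mem_Icc.2 h'.lt.le
  have hu := right_mem_Icc.2 h'.lt.le
  have hends : g l' = g u' := h.injOn (hm hl) (hm hu)
    (by rw [hs _ hl, hs _ hu, h'.apply_left, h'.apply_right])
  exact hbr ▸ isEFBoundaryArc_branch hA hB h.overlap_eq h.lt h.left_mem h.right_mem h' hg
    hm hs hends

/-- By `hr` the share of the second player stays between `e` and the turning value of the first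
player without reaching the latter. It can therefore be lifted to each side of `m`, and the payoff
of the first player, compared with `m`, separates the two branches. -/
theorem hasTwoEFArcs_of_turning (hA : DistinctEntries (X 0)) (hB : DistinctEntries (X 1)ᵀ)
    {e l u m l' u' m' : ℝ} (h : TurningOverlap (X 0) e l u m)
    (h' : TurningOverlap (X 1)ᵀ e l' u' m')
    (hr : ∀ w ∈ Icc l' u', payoffShare (X 1)ᵀ w ∈ uIcc e (payoffShare (X 0) m) ∧
      payoffShare (X 1)ᵀ w ≠ payoffShare (X 0) m) : HasTwoEFArcs X := by
  have hl' := left_mem_Icc.2 h'.lt.le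
  have hu' := right_mem_Icc.2 h'.lt.le
  have hJ : (Icc l' u').Nonempty := ⟨l', hl'⟩
  have hcA := hA.continuous_payoffShare
  have hcB := hB.continuous_payoffShare.continuousOn (s := Icc l' u')
  have hleft : ∀ w ∈ Icc l' u', payoffShare (X 1)ᵀ w ∈ payoffShare (X 0) '' Icc l m := by
    intro w hw
    have hivt := intermediate_value_uIcc (a := l) (b := m) hcA.continuousOn
    rw [uIcc_of_le h.left_lt.le, h.apply_left] at hivt
    exact hivt (hr w hw).1
  have hright : ∀ w ∈ Icc l' u', payoffShare (X 1)ᵀ w ∈ payoffShare (X 0) '' Icc m u := by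
    intro w hw
    have hivt := intermediate_value_uIcc (a := m) (b := u) hcA.continuousOn
    rw [uIcc_of_le h.lt_right.le, h.apply_right, uIcc_comm] at hivt
    exact hivt (hr w hw).1
  obtain ⟨g₁, hg₁, hm₁, hs₁⟩ := exists_continuousOn_lift isCompact_Icc hcA.continuousOn
    h.injOn_left hJ hcB hleft
  obtain ⟨g₂, hg₂, hm₂, hs₂⟩ := exists_continuousOn_lift isCompact_Icc hcA.continuousOn
    h.injOn_right hJ hcB hright
  have hl : payoffShare (X 0) l = 0 ∨ payoffShare (X 0) l = 1 := h.apply_left ▸ h.value_mem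
  have hu : payoffShare (X 0) u = 0 ∨ payoffShare (X 0) u = 1 := h.apply_right ▸ h.value_mem
  have hee : payoffShare (X 1)ᵀ l' = payoffShare (X 1)ᵀ u' :=
    h'.apply_left.trans h'.apply_right.symm
  have e₁ : g₁ l' = g₁ u' := h.injOn_left (hm₁ hl') (hm₁ hu') (by rw [hs₁ _ hl', hs₁ _ hu', hee])
  have e₂ : g₂ l' = g₂ u' := h.injOn_right (hm₂ hl') (hm₂ hu') (by rw [hs₂ _ hl', hs₂ _ hu', hee])
  refine ⟨branch X g₁, branch X g₂, ?_,
    isEFBoundaryArc_branch hA hB h.overlap_eq h.lt hl hu h' hg₁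
      (fun w hw => Icc_subset_Icc_right h.lt_right.le (hm₁ hw)) hs₁ e₁,
    isEFBoundaryArc_branch hA hB h.overlap_eq h.lt hl hu h' hg₂
      (fun w hw => Icc_subset_Icc_left h.left_lt.le (hm₂ hw)) hs₂ e₂,
    payoff (X 0), continuous_payoff _, m, ?_, ?_⟩
  · apply Subset.antisymm
    · intro P hP
      obtain ⟨hv, hw, he⟩ := payoffShare_eq_of_mem_equilibriumCurve hA hB hP
      rw [h.overlap_eq] at hv
      rw [h'.overlap_eq] at hw
      have hw' := Ioo_subset_Icc_self hw
      rcases le_total (payoff (X 0) P) m with hle | hle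
      · exact Or.inl ⟨hP, h.injOn_left ⟨hv.1.le, hle⟩ (hm₁ hw') (he.trans (hs₁ _ hw').symm)⟩
      · exact Or.inr ⟨hP, h.injOn_right ⟨hle, hv.2.le⟩ (hm₂ hw') (he.trans (hs₂ _ hw').symm)⟩
    · exact union_subset (fun P hP => hP.1) fun P hP => hP.1
  · intro P hP
    obtain ⟨hP, hg⟩ := hP
    obtain ⟨-, hw, he⟩ := payoffShare_eq_of_mem_equilibriumCurve hA hB hP
    rw [h'.overlap_eq] at hw
    have hw' := Ioo_subset_Icc_self hw
    refine lt_of_le_of_ne (hg ▸ (hm₁ hw').2) fun hne => (hr _ hw').2 ?_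
    rw [← he, hne]
  · intro P hP
    obtain ⟨hP, hg⟩ := hP
    obtain ⟨-, hw, he⟩ := payoffShare_eq_of_mem_equilibriumCurve hA hB hP
    rw [h'.overlap_eq] at hw
    have hw' := Ioo_subset_Icc_self hw
    refine lt_of_le_of_ne (hg ▸ (hm₂ hw').1) fun hne => (hr _ hw').2 ?_
    rw [← he, ← hne]

/-- The resultant of the two quadratic forms `shareDiscr` in `(1 - c, c)`. -/
def shareResultant (A B : Matrix (Fin 2) (Fin 2) ℝ) : ℝ :=
  ((A 0 1 - A 1 0) ^ 2 * (B 0 0 - B 1 1) ^ 2 - (A 0 0 - A 1 1) ^ 2 * (B 0 1 - B 1 0) ^ 2) ^ 2 -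
  ((A 0 1 - A 1 0) ^ 2 *
      (2 * (B 0 1 + B 1 0) * (B 0 0 + B 1 1) - 4 * B 0 1 * B 1 0 - 4 * B 0 0 * B 1 1) -
    (2 * (A 0 1 + A 1 0) * (A 0 0 + A 1 1) - 4 * A 0 1 * A 1 0 - 4 * A 0 0 * A 1 1) *
      (B 0 1 - B 1 0) ^ 2) *
  ((2 * (A 0 1 + A 1 0) * (A 0 0 + A 1 1) - 4 * A 0 1 * A 1 0 - 4 * A 0 0 * A 1 1) *
      (B 0 0 - B 1 1) ^ 2 -
    (A 0 0 - A 1 1) ^ 2 *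
      (2 * (B 0 1 + B 1 0) * (B 0 0 + B 1 1) - 4 * B 0 1 * B 1 0 - 4 * B 0 0 * B 1 1))

/-- Two binary quadratic forms with a common zero have vanishing resultant. Eliminating the outer
coefficients in turn gives two linear relations between `s` and `t`, whose determinant is the
resultant. -/
theorem resultant_eq_zero {E G H E' G' H' s t : ℝ} (hs : s ≠ 0) (ht : t ≠ 0)
    (h : E * s ^ 2 - G * (s * t) + H * t ^ 2 = 0)
    (h' : E' * s ^ 2 - G' * (s * t) + H' * t ^ 2 = 0) :
    (E * H' - H * E') ^ 2 - (E * G' - G * E') * (G * H' - H * G') = 0 := by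
  have h₁ : (E * G' - G * E') * s = (E * H' - H * E') * t :=
    mul_left_cancel₀ ht (by linear_combination E' * h - E * h')
  have h₂ : (E * H' - H * E') * s = (G * H' - H * G') * t :=
    mul_left_cancel₀ hs (by linear_combination H' * h - H * h')
  apply mul_left_cancel₀ ht
  linear_combination -(E * H' - H * E') * h₁ + (E * G' - G * E') * h₂

theorem shareResultant_eq_zero {A B : Matrix (Fin 2) (Fin 2) ℝ} {c : ℝ} (h0 : 0 < c) (h1 : c < 1)
    (hA : shareDiscr (A 0 1) (A 1 0) (A 0 0) (A 1 1) c = 0)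
    (hB : shareDiscr (B 0 1) (B 1 0) (B 0 0) (B 1 1) c = 0) : shareResultant A B = 0 :=
  resultant_eq_zero (sub_pos.2 h1).ne' h0.ne' hA hB

/-- Equal turning values would be a common zero of both discriminants, which `hR` excludes. The
player whose turning value is farther from `e` is the one whose share is inverted; exchanging the
players covers the case where this is the second. -/
theorem hasTwoEFArcs_of_turning_turning (hA : DistinctEntries (X 0))
    (hB : DistinctEntries (X 1)ᵀ) (hR : shareResultant (X 0) (X 1)ᵀ ≠ 0)
    {e l u m l' u' m' : ℝ} (h : TurningOverlap (X 0) e l u m)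
    (h' : TurningOverlap (X 1)ᵀ e l' u' m') : HasTwoEFArcs X := by
  have hne : payoffShare (X 0) m ≠ payoffShare (X 1)ᵀ m' := by
    intro heq
    have h01 : 0 < payoffShare (X 0) m ∧ payoffShare (X 0) m < 1 := by
      rcases h.bounds with ⟨-, h₁, h₂, -⟩ | ⟨-, h₁, h₂, -⟩ <;> constructor <;> linarith
    exact hR (shareResultant_eq_zero h01.1 h01.2 h.discr_eq (heq ▸ h'.discr_eq))
  have range : ∀ {A B : Matrix (Fin 2) (Fin 2) ℝ} {l u m l' u' m' : ℝ},
      TurningOverlap A 0 l u m → TurningOverlap B 0 l' u' m' →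
      payoffShare B m' < payoffShare A m → ∀ w ∈ Icc l' u',
      payoffShare B w ∈ uIcc 0 (payoffShare A m) ∧ payoffShare B w ≠ payoffShare A m := by
    intro A B l u m l' u' m' h h' hlt w hw
    rcases h'.bounds with ⟨-, h₁, h₂, h₃⟩ | ⟨h₁, -⟩
    · have := h₃ w hw
      exact ⟨mem_uIcc_of_le (share_nonneg _ _ _ _ _) (by linarith), by linarith⟩
    · norm_num at h₁
  have range' : ∀ {A B : Matrix (Fin 2) (Fin 2) ℝ} {l u m l' u' m' : ℝ},
      TurningOverlap A 1 l u m → TurningOverlap B 1 l' u' m' →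
      payoffShare A m < payoffShare B m' → ∀ w ∈ Icc l' u',
      payoffShare B w ∈ uIcc 1 (payoffShare A m) ∧ payoffShare B w ≠ payoffShare A m := by
    intro A B l u m l' u' m' h h' hlt w hw
    rcases h'.bounds with ⟨h₁, -⟩ | ⟨-, h₁, h₂, h₃⟩
    · norm_num at h₁
    · have := h₃ w hw
      exact ⟨mem_uIcc_of_ge (by linarith) (share_le_one _ _ _ _ _), by linarith⟩
  rcases h.value_mem with rfl | rfl <;> rcases lt_or_gt_of_ne hne with hlt | hlt
  · exact (hasTwoEFArcs_of_turning (X := X.swap) hB hA h' h (range h' h hlt)).of_swap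
  · exact hasTwoEFArcs_of_turning hA hB h h' (range h h' hlt)
  · exact hasTwoEFArcs_of_turning hA hB h h' (range' h h' hlt)
  · exact (hasTwoEFArcs_of_turning (X := X.swap) hB hA h' h (range' h' h hlt)).of_swap

theorem equilibriumCurve_eq_empty (hA : DistinctEntries (X 0)) (hB : DistinctEntries (X 1)ᵀ)
    (h : overlap (X 0) = ∅ ∨ overlap (X 1)ᵀ = ∅) : equilibriumCurve X = ∅ := by
  refine eq_empty_of_forall_notMem fun P hP => ?_
  obtain ⟨hv, hw, -⟩ := payoffShare_eq_of_mem_equilibriumCurve hA hB hP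
  rcases h with h | h
  · rw [h] at hv
    exact hv
  · rw [h] at hw
    exact hw

/-- A share turning from `0` stays below `1/2` and one turning from `1` stays above, so they never
agree. -/
theorem equilibriumCurve_eq_empty_of_turning (hA : DistinctEntries (X 0))
    (hB : DistinctEntries (X 1)ᵀ) {e l u m e' l' u' m' : ℝ} (h : TurningOverlap (X 0) e l u m)
    (h' : TurningOverlap (X 1)ᵀ e' l' u' m') (hne : e ≠ e') : equilibriumCurve X = ∅ := by
  refine eq_empty_of_forall_notMem fun P hP => ?_
  obtain ⟨hv, hw, he⟩ := payoffShare_eq_of_mem_equilibriumCurve hA hB hP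
  rw [h.overlap_eq] at hv
  rw [h'.overlap_eq] at hw
  have hv' := Ioo_subset_Icc_self hv
  have hw' := Ioo_subset_Icc_self hw
  rcases h.bounds with ⟨h₁, h₂, h₃, h₄⟩ | ⟨h₁, h₂, h₃, h₄⟩ <;>
    rcases h'.bounds with ⟨k₁, k₂, k₃, k₄⟩ | ⟨k₁, k₂, k₃, k₄⟩
  · exact hne (h₁.trans k₁.symm)
  · linarith [h₄ _ hv', k₄ _ hw']
  · linarith [h₄ _ hv', k₄ _ hw']
  · exact hne (h₁.trans k₁.symm)

theorem signCondition_iff (hA : DistinctEntries (X 0)) (hB : DistinctEntries (X 1)ᵀ) :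
    SignCondition X ↔ Coordinating (X 0) ∧ Coordinating (X 1)ᵀ := by
  have key : ∀ {x y : ℝ}, x ≠ 0 → y ≠ 0 → (SignType.sign x = SignType.sign y ↔ 0 < x * y) := by
    intro x y hx hy
    rcases lt_or_gt_of_ne hx with h | h <;> rcases lt_or_gt_of_ne hy with h' | h'
    · simp [sign_neg h, sign_neg h', mul_pos_of_neg_of_neg h h']
    · simp [sign_neg h, sign_pos h', (mul_neg_of_neg_of_pos h h').le]
    · simp [sign_pos h, sign_neg h', (mul_neg_of_pos_of_neg h h').le]
    · simp [sign_pos h, sign_pos h', mul_pos h h']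
  exact and_congr (key (sub_ne_zero.2 hA.h00_10) (sub_ne_zero.2 hA.h01_11.symm))
    (key (sub_ne_zero.2 hB.h00_10) (sub_ne_zero.2 hB.h01_11.symm))

end Decomposition

/-! ### Generic games and examples for each number of components. -/

section Generic

open Set Matrix

variable {X : Game}

theorem IsArcBetween.encard_components {S : Set (Matrix (Fin 2) (Fin 2) ℝ)}
    {P Q : Matrix (Fin 2) (Fin 2) ℝ} (h : IsArcBetween S P Q) :
    components S = {S} ∧ (components S).encard = 1 := by
  have := components_of_isPreconnected h.isPreconnected h.nonempty
  exact ⟨this, by rw [this, encard_singleton]⟩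

theorem IsEFBoundaryArc.encard_components {S : Set (Matrix (Fin 2) (Fin 2) ℝ)}
    (h : IsEFBoundaryArc X S) : components S = {S} ∧ (components S).encard = 1 := by
  obtain ⟨P, Q, -, -, h⟩ := h
  exact h.encard_components

theorem IsEFBoundaryArc.isBoundaryArc {C : Set (Matrix (Fin 2) (Fin 2) ℝ)}
    (h : IsEFBoundaryArc X C) : IsBoundaryArc C := by
  obtain ⟨P, Q, hP, hQ, h⟩ := h
  exact ⟨P, hP.2, Q, hQ.2, h⟩

theorem IsEFBoundaryArc.isEFArc {C : Set (Matrix (Fin 2) (Fin 2) ℝ)}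
    (h : IsEFBoundaryArc X C) : IsEFArc X C := by
  obtain ⟨P, Q, hP, hQ, h⟩ := h
  exact ⟨P, Q, hP.1, hQ.1, h⟩

theorem HasTwoEFArcs.encard_components (h : HasTwoEFArcs X) :
    (∀ C ∈ components (equilibriumCurve X), IsEFBoundaryArc X C) ∧
      (components (equilibriumCurve X)).encard = 2 := by
  obtain ⟨C₁, C₂, hC, h₁, h₂, ξ, hξ, c, hc₁, hc₂⟩ := h
  obtain ⟨_, _, -, -, a₁⟩ := id h₁
  obtain ⟨_, _, -, -, a₂⟩ := id h₂
  obtain ⟨he, hne⟩ := components_union_of_separated a₁.isPreconnected a₂.isPreconnected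
    a₁.nonempty a₂.nonempty hξ hc₁ hc₂
  rw [hC, he]
  refine ⟨?_, encard_pair hne⟩
  rintro C (rfl | rfl)
  · exact h₁
  · exact h₂

/-- The nondegeneracy conditions on a game under which its curve of dependency equilibria is
analysed. -/
structure Nondegenerate (X : Game) : Prop where
  left : DistinctEntries (X 0)
  right : DistinctEntries (X 1)ᵀ
  resultant_ne_zero : shareResultant (X 0) (X 1)ᵀ ≠ 0

theorem isEFBoundaryArc_of_turning_monotone (hA : DistinctEntries (X 0))
    (hB : DistinctEntries (X 1)ᵀ) {e l u m l' u' : ℝ} (h : TurningOverlap (X 0) e l u m)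
    (h' : MonotoneOverlap (X 1)ᵀ l' u') : IsEFBoundaryArc X (equilibriumCurve X) := by
  rw [equilibriumCurve_swap]
  exact (isEFBoundaryArc_of_monotone_turning (X := X.swap) hB hA h' h).transpose

theorem Nondegenerate.equilibriumCurve_cases (h : Nondegenerate X) :
    (SignCondition X ∧ ∃ P Q, ((IsE P ∨ IsF X P) ∧ P ∈ simplexBoundary) ∧
      ((IsE Q ∨ IsF X Q) ∧ Q ∈ simplexBoundary) ∧ IsArcBetween (equilibriumCurve X) P Q) ∨
    (¬ SignCondition X ∧ (equilibriumCurve X = ∅ ∨ IsEFBoundaryArc X (equilibriumCurve X) ∨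
      HasTwoEFArcs X)) := by
  obtain ⟨hA, hB, hR⟩ := h
  rw [signCondition_iff hA hB]
  rcases overlap_trichotomy hA with ⟨h, hn⟩ | ⟨hs, l, u, h⟩ | ⟨hn, e, l, u, m, h⟩
  · exact Or.inr ⟨fun hc => hn hc.1, Or.inl (equilibriumCurve_eq_empty hA hB (Or.inl h))⟩
  · rcases overlap_trichotomy hB with ⟨h', hn'⟩ | ⟨hs', l', u', h'⟩ | ⟨hn', e', l', u', m', h'⟩
    · exact Or.inr ⟨fun hc => hn' hc.2, Or.inl (equilibriumCurve_eq_empty hA hB (Or.inr h'))⟩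
    · exact Or.inl ⟨⟨hs, hs'⟩, exists_isArcBetween_of_monotone hA hB h h'⟩
    · exact Or.inr ⟨fun hc => hn' hc.2,
        Or.inr (Or.inl (isEFBoundaryArc_of_monotone_turning hA hB h h'))⟩
  · refine Or.inr ⟨fun hc => hn hc.1, ?_⟩
    rcases overlap_trichotomy hB with ⟨h', -⟩ | ⟨-, l', u', h'⟩ | ⟨-, e', l', u', m', h'⟩
    · exact Or.inl (equilibriumCurve_eq_empty hA hB (Or.inr h'))
    · exact Or.inr (Or.inl (isEFBoundaryArc_of_turning_monotone hA hB h h'))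
    · by_cases hee : e = e'
      · subst hee
        exact Or.inr (Or.inr (hasTwoEFArcs_of_turning_turning hA hB hR h h'))
      · exact Or.inl (equilibriumCurve_eq_empty_of_turning hA hB h h' hee)

/-- A polynomial in the payoffs whose nonvanishing makes a game nondegenerate. -/
noncomputable def nondegeneracyPolynomial : MvPolynomial (Fin 2 × Fin 2 × Fin 2) ℝ :=
  let a : Fin 2 → Fin 2 → MvPolynomial (Fin 2 × Fin 2 × Fin 2) ℝ :=
    fun i j => MvPolynomial.X (0, i, j)
  -- The indices are exchanged because the payoffs of the second player enter transposed.
  let b : Fin 2 → Fin 2 → MvPolynomial (Fin 2 × Fin 2 × Fin 2) ℝ :=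
    fun i j => MvPolynomial.X (1, j, i)
  let d : (Fin 2 → Fin 2 → MvPolynomial (Fin 2 × Fin 2 × Fin 2) ℝ) →
      MvPolynomial (Fin 2 × Fin 2 × Fin 2) ℝ := fun c =>
    (c 0 0 - c 0 1) * (c 0 0 - c 1 0) * (c 0 0 - c 1 1) * (c 0 1 - c 1 0) * (c 0 1 - c 1 1) *
      (c 1 0 - c 1 1)
  let g : (Fin 2 → Fin 2 → MvPolynomial (Fin 2 × Fin 2 × Fin 2) ℝ) →
      MvPolynomial (Fin 2 × Fin 2 × Fin 2) ℝ := fun c =>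
    2 * (c 0 1 + c 1 0) * (c 0 0 + c 1 1) - 4 * c 0 1 * c 1 0 - 4 * c 0 0 * c 1 1
  d a * d b *
    (((a 0 1 - a 1 0) ^ 2 * (b 0 0 - b 1 1) ^ 2 - (a 0 0 - a 1 1) ^ 2 * (b 0 1 - b 1 0) ^ 2) ^ 2 -
      ((a 0 1 - a 1 0) ^ 2 * g b - g a * (b 0 1 - b 1 0) ^ 2) *
      (g a * (b 0 0 - b 1 1) ^ 2 - (a 0 0 - a 1 1) ^ 2 * g b))

/-- The product of the differences of the entries. -/
def entryDiscriminant (A : Matrix (Fin 2) (Fin 2) ℝ) : ℝ :=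
  (A 0 0 - A 0 1) * (A 0 0 - A 1 0) * (A 0 0 - A 1 1) * (A 0 1 - A 1 0) * (A 0 1 - A 1 1) *
    (A 1 0 - A 1 1)

theorem distinctEntries_of_entryDiscriminant_ne_zero {A : Matrix (Fin 2) (Fin 2) ℝ}
    (h : entryDiscriminant A ≠ 0) : DistinctEntries A := by
  simp only [entryDiscriminant, mul_ne_zero_iff, sub_ne_zero] at h
  obtain ⟨⟨⟨⟨⟨h₁, h₂⟩, h₃⟩, h₄⟩, h₅⟩, h₆⟩ := h
  exact ⟨h₁, h₂, h₃, h₄, h₅, h₆⟩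

theorem eval_nondegeneracyPolynomial (X : Game) :
    MvPolynomial.eval (fun v => X v.1 v.2.1 v.2.2) nondegeneracyPolynomial =
      entryDiscriminant (X 0) * entryDiscriminant (X 1)ᵀ * shareResultant (X 0) (X 1)ᵀ := by
  simp only [nondegeneracyPolynomial, map_mul, map_sub, map_add, map_pow, map_ofNat,
    MvPolynomial.eval_X, entryDiscriminant, shareResultant, transpose_apply]

theorem nondegenerate_of_eval_ne_zero
    (h : MvPolynomial.eval (fun v => X v.1 v.2.1 v.2.2) nondegeneracyPolynomial ≠ 0) :
    Nondegenerate X := by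
  rw [eval_nondegeneracyPolynomial, mul_ne_zero_iff, mul_ne_zero_iff] at h
  exact ⟨distinctEntries_of_entryDiscriminant_ne_zero h.1.1,
    distinctEntries_of_entryDiscriminant_ne_zero h.1.2, h.2⟩

theorem nondegeneracyPolynomial_ne_zero : nondegeneracyPolynomial ≠ 0 := by
  intro h
  have := eval_nondegeneracyPolynomial ![!![0, 1; 2, 4], !![0, 3; 1, 2]]
  rw [h, map_zero] at this
  norm_num [entryDiscriminant, shareResultant] at this

/-- A nonzero polynomial in the payoffs does not vanish on the nondegenerate games of an open
box. -/
theorem exists_nondegenerate_mem_box {D : MvPolynomial (Fin 2 × Fin 2 × Fin 2) ℝ} (hD : D ≠ 0)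
    (c : Game) : ∃ X : Game, MvPolynomial.eval (fun v => X v.1 v.2.1 v.2.2) D ≠ 0 ∧
      Nondegenerate X ∧ ∀ k i j, c k i j < X k i j ∧ X k i j < c k i j + 1 := by
  by_contra! hcon
  refine mul_ne_zero hD nondegeneracyPolynomial_ne_zero ?_
  -- A polynomial that vanishes on a product of infinite sets is zero; it is applied to the product
  -- of `D` with the nondegeneracy polynomial.
  refine MvPolynomial.funext_set (fun v => Ioo (c v.1 v.2.1 v.2.2) (c v.1 v.2.1 v.2.2 + 1))
    (fun v => Ioo_infinite (lt_add_one _)) fun x hx => ?_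
  rw [map_zero, map_mul]
  by_contra hne
  obtain ⟨h₁, h₂⟩ := mul_ne_zero_iff.1 hne
  obtain ⟨k, i, j, h⟩ := hcon (fun k => Matrix.of fun i j => x (k, i, j)) h₁
    (nondegenerate_of_eval_ne_zero h₂)
  have hx' := hx (k, i, j) (mem_univ _)
  exact (h hx'.1).not_gt hx'.2

theorem not_coordinating {A : Matrix (Fin 2) (Fin 2) ℝ} (h : A 1 0 < A 0 0) (h' : A 1 1 < A 0 1) :
    ¬ Coordinating A :=
  (mul_neg_of_pos_of_neg (sub_pos.2 h) (sub_neg.2 h')).not_gt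

theorem overlap_eq_empty_of_lt {A : Matrix (Fin 2) (Fin 2) ℝ} {c : ℝ} (h00 : A 0 0 < c)
    (h01 : A 0 1 < c) (h10 : c < A 1 0) (h11 : c < A 1 1) : overlap A = ∅ := by
  refine eq_empty_of_forall_notMem fun v hv => ?_
  rcases mul_pos_iff.1 hv.1 with h | h <;> rcases mul_pos_iff.1 hv.2 with h' | h' <;> linarith

theorem possibleForGeneric_zero : PossibleForGeneric fun X =>
    ¬ SignCondition X ∧ (components (equilibriumCurve X)).encard = 0 := by
  intro D hD
  obtain ⟨X, hX, ⟨hA, hB, -⟩, hbox⟩ :=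
    -- The box puts the first row in `(0, 1)` and the second in `(2, 3)`, so the row intervals are
    -- disjoint whatever the second player's payoffs.
    exists_nondegenerate_mem_box hD ![!![0, 0; 2, 2], !![0, 0; 0, 0]]
  have h00 := hbox 0 0 0
  have h01 := hbox 0 0 1
  have h10 := hbox 0 1 0
  have h11 := hbox 0 1 1
  norm_num at h00 h01 h10 h11
  refine ⟨X, hX, ?_, ?_⟩
  · rw [signCondition_iff hA hB]
    refine fun h => lt_asymm h.1 (mul_neg_of_neg_of_pos ?_ ?_) <;> linarith
  · have he : overlap (X 0) = ∅ := overlap_eq_empty_of_lt (c := 2) (by linarith) (by linarith)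
      (by linarith) (by linarith)
    rw [equilibriumCurve_eq_empty hA hB (Or.inl he), components_empty, encard_empty]

theorem possibleForGeneric_one : PossibleForGeneric fun X =>
    ¬ SignCondition X ∧ (components (equilibriumCurve X)).encard = 1 := by
  intro D hD
  obtain ⟨X, hX, ⟨hA, hB, -⟩, hbox⟩ :=
    -- The lower corners are two apart and the box has width one, so the order of the entries is
    -- fixed: `a₂₂ < a₁₂ < a₂₁ < a₁₁` makes the first share turn from `0`, while the second player
    -- is coordinating.
    exists_nondegenerate_mem_box hD ![!![6, 2; 4, 0], !![6, 0; 2, 4]]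
  have h00 := hbox 0 0 0
  have h01 := hbox 0 0 1
  have h10 := hbox 0 1 0
  have h11 := hbox 0 1 1
  have k00 := hbox 1 0 0
  have k01 := hbox 1 0 1
  have k10 := hbox 1 1 0
  have k11 := hbox 1 1 1
  norm_num at h00 h01 h10 h11 k00 k01 k10 k11
  refine ⟨X, hX, ?_, ?_⟩
  · rw [signCondition_iff hA hB]
    exact fun h => not_coordinating (by linarith) (by linarith) h.1
  · obtain ⟨m, hm⟩ := exists_turningOverlap_zero_of_lt hA (by linarith) (by linarith) (by linarith)
    have hc : Coordinating (X 1)ᵀ := by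
      refine mul_pos ?_ ?_ <;> simp only [transpose_apply] <;> linarith
    rcases overlap_trichotomy hB with ⟨-, hn⟩ | ⟨-, l, u, h⟩ | ⟨hn, -⟩
    · exact absurd hc hn
    · exact (isEFBoundaryArc_of_turning_monotone hA hB hm h).encard_components.2
    · exact absurd hc hn

theorem possibleForGeneric_two : PossibleForGeneric fun X =>
    ¬ SignCondition X ∧ (components (equilibriumCurve X)).encard = 2 := by
  intro D hD
  obtain ⟨X, hX, ⟨hA, hB, hR⟩, hbox⟩ :=
    -- The transposed matrix of the second player has the same order of entries as that of the
    -- first, so both shares turn from `0`.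
    exists_nondegenerate_mem_box hD ![!![6, 2; 4, 0], !![6, 4; 2, 0]]
  have h00 := hbox 0 0 0
  have h01 := hbox 0 0 1
  have h10 := hbox 0 1 0
  have h11 := hbox 0 1 1
  have k00 := hbox 1 0 0
  have k01 := hbox 1 0 1
  have k10 := hbox 1 1 0
  have k11 := hbox 1 1 1
  norm_num at h00 h01 h10 h11 k00 k01 k10 k11
  refine ⟨X, hX, ?_, ?_⟩
  · rw [signCondition_iff hA hB]
    exact fun h => not_coordinating (by linarith) (by linarith) h.1
  · obtain ⟨m, hm⟩ := exists_turningOverlap_zero_of_lt hA (by linarith) (by linarith) (by linarith)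
    obtain ⟨m', hm'⟩ := exists_turningOverlap_zero_of_lt hB
      (by simp only [transpose_apply]; linarith) (by simp only [transpose_apply]; linarith)
      (by simp only [transpose_apply]; linarith)
    exact (hasTwoEFArcs_of_turning_turning hA hB hR hm hm').encard_components.2

end Generic

end Spohn

/-! ### Assembly of the main theorem. -/

theorem theorem4p3 :
    Spohn.ForGeneric (fun X =>
      ((Spohn.components (Spohn.equilibriumCurve X)).encard = 0 ∨
        (Spohn.components (Spohn.equilibriumCurve X)).encard = 1 ∨
        (Spohn.components (Spohn.equilibriumCurve X)).encard = 2) ∧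
      (∀ C ∈ Spohn.components (Spohn.equilibriumCurve X), Spohn.IsBoundaryArc C) ∧
      (Spohn.SignCondition X →
        (Spohn.components (Spohn.equilibriumCurve X)).encard = 1 ∧
        ∀ C ∈ Spohn.components (Spohn.equilibriumCurve X),
          Spohn.IsEEArc C ∨ Spohn.IsEFArc X C ∨ Spohn.IsFFArc X C) ∧
      (¬ Spohn.SignCondition X →
        ∀ C ∈ Spohn.components (Spohn.equilibriumCurve X), Spohn.IsEFArc X C)) ∧
    (∀ k : ℕ, k ≤ 2 →
      Spohn.PossibleForGeneric (fun X => ¬ Spohn.SignCondition X ∧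
        (Spohn.components (Spohn.equilibriumCurve X)).encard = k)) := by
  refine ⟨⟨Spohn.nondegeneracyPolynomial, Spohn.nondegeneracyPolynomial_ne_zero,
    fun X hX => ?_⟩, fun k hk => ?_⟩
  · rcases (Spohn.nondegenerate_of_eval_ne_zero hX).equilibriumCurve_cases with
      ⟨hs, P, Q, ⟨hP, hP'⟩, ⟨hQ, hQ'⟩, hC⟩ | ⟨hs, h | h | h⟩
    · obtain ⟨he, hn⟩ := hC.encard_components
      refine ⟨Or.inr (Or.inl hn), ?_, fun _ => ⟨hn, ?_⟩, fun hs' => absurd hs hs'⟩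
      · rw [he]
        rintro C rfl
        exact ⟨P, hP', Q, hQ', hC⟩
      · rw [he]
        rintro C rfl
        rcases hP with hP | hP <;> rcases hQ with hQ | hQ
        · exact Or.inl ⟨P, Q, hP, hQ, hC⟩
        · exact Or.inr (Or.inl ⟨P, Q, hP, hQ, hC⟩)
        · exact Or.inr (Or.inl ⟨Q, P, hQ, hP, hC.symm⟩)
        · exact Or.inr (Or.inr ⟨P, Q, hP, hQ, hC⟩)
    · rw [h, Spohn.components_empty]
      exact ⟨Or.inl Set.encard_empty, fun C hC => absurd hC (Set.notMem_empty C),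
        fun hs' => absurd hs' hs, fun _ C hC => absurd hC (Set.notMem_empty C)⟩
    · obtain ⟨he, hn⟩ := h.encard_components
      refine ⟨Or.inr (Or.inl hn), ?_, fun hs' => absurd hs' hs, fun _ => ?_⟩
      · rw [he]
        rintro C rfl
        exact h.isBoundaryArc
      · rw [he]
        rintro C rfl
        exact h.isEFArc
    · obtain ⟨he, hn⟩ := h.encard_components
      exact ⟨Or.inr (Or.inr hn), fun C hC => (he C hC).isBoundaryArc,
        fun hs' => absurd hs' hs, fun _ C hC => (he C hC).isEFArc⟩
  · interval_cases k
    · exact Spohn.possibleForGeneric_zero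
    · exact Spohn.possibleForGeneric_one
    · exact Spohn.possibleForGeneric_two
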